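/- Let $r>3$, $p(z_1,z_2,z_3)=1-\frac{z_1+z_2+z_3}{r}$, and let $c_J=c_{j_1j_2j_3}$, $J=(j_1,j_2,j_3)\in\mathbb Z^3$, be the Fourier coefficients of $1/|p|^2$ on the torus $\mathbb T^3=\{|z_1|=|z_2|=|z_3|=1\}$, that is, $\frac{1}{|p(z)|^2}=\sum_{J\in\mathbb Z^3}c_Jz_1^{j_1}z_2^{j_2}z_3^{j_3}$ for $z\in\mathbb T^3$. Let $$K(m)=\int_0^{\pi/2}\frac{dt}{\sqrt{1-m\sin^2t}},\quad E(m)=\int_0^{\pi/2}\sqrt{1-m\sin^2t}\,dt,\quad \Pi(n,m)=\int_0^{\pi/2}\frac{dt}{(1-n\sin^2t)\sqrt{1-m\sin^2t}}$$ be the complete elliptic integrals of the first, second and third kind, and put $m=\frac{16r}{(r+3)(r-1)^3}$. Then $$c_{100}=\frac r3(c_{000}-1),$$ $$c_{011}=\frac13(c_{000}-1)+\frac{(r^4-2r^2-15)K(m)-(r+3)(r-1)^3E(m)-4(r-3)(r+1)\,\Pi\!\left(\frac{4r}{(r+3)(r-1)},m\right)}{4\pi(r-1)\sqrt{(r+3)(r-1)}}$$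 $$=\frac13(c_{000}-1)-\frac12+\frac{(r+3)(r-1)^3K(m)-(r+3)(r-1)^3E(m)+4(r-3)(r+1)\,\Pi\!\left(\frac{4}{(r-1)^2},m\right)}{4\pi(r-1)\sqrt{(r+3)(r-1)}},$$ $$c_{111}=\frac3r c_{011},\qquad c_{0,1,-1}=\frac12(rc_{001}-c_{000}),\qquad c_{1,1,-1}=rc_{011}-2c_{001}.$$ Moreover, for every $J\in\{-1,0,1\}^3$ and every permutation $\sigma$ of the three entries, $c_J=c_{\sigma(J)}=c_{-J}$, and every $J\in\{-1,0,1\}^3$ is, up to a permutation of its entries and a global sign change, one of $(0,0,0),(1,0,0),(0,1,1),(1,1,1),(0,1,-1),(1,1,-1)$; so all $c_J$ with $J\in\{-1,0,1\}^3$ are obtained from the ones above. -/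

import Mathlib

noncomputable section

/-- Complete elliptic integral of the first kind, as a function of the parameter `m`. -/
def ellipticK (m : ℝ) : ℝ :=
  ∫ t in (0 : ℝ)..(Real.pi / 2), 1 / Real.sqrt (1 - m * Real.sin t ^ 2)

/-- Complete elliptic integral of the second kind, as a function of the parameter `m`. -/
def ellipticE (m : ℝ) : ℝ :=
  ∫ t in (0 : ℝ)..(Real.pi / 2), Real.sqrt (1 - m * Real.sin t ^ 2)

/-- Complete elliptic integral of the third kind, with characteristic `n` and parameter `m`. -/
def ellipticPi (n m : ℝ) : ℝ :=
  ∫ t in (0 : ℝ)..(Real.pi / 2),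
    1 / ((1 - n * Real.sin t ^ 2) * Real.sqrt (1 - m * Real.sin t ^ 2))

/-- The polynomial `p(z₁, z₂, z₃) = 1 - (z₁ + z₂ + z₃) / r`. -/
def pPoly (r : ℝ) (z : Fin 3 → ℂ) : ℂ := 1 - (z 0 + z 1 + z 2) / (r : ℂ)

/-- The spectral density `1 / |p(z)|²` on the torus `𝕋³`, parametrised by angles:
the point with coordinates `θ i ∈ ℝ / ℤ` is `z i = exp (2 π i θ i)`. -/
def specDensity (r : ℝ) (θ : UnitAddTorus (Fin 3)) : ℂ :=
  ((1 / ‖pPoly r (fun i => (AddCircle.toCircle (θ i) : ℂ))‖ ^ 2 : ℝ) : ℂ)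

/-- The Fourier coefficients `c_J`, `J ∈ ℤ³`, of `1 / |p|²` on `𝕋³`. -/
def fourierC (r : ℝ) (J : Fin 3 → ℤ) : ℂ := UnitAddTorus.mFourierCoeff (specDensity r) J

end

/-! Two independent mechanisms produce the formulas. The first is linear. On the torus `p / |p|²` is
the conjugate of `1 / p`, and `1 / p` is holomorphic on the closed polydisc because `r > 3`.
Comparing Fourier coefficients at nonnegative `J` gives `c_J - (1/r) ∑ₖ c_{J - eₖ} = δ_{J,0}`
(`fourierC_recurrence`). With invariance under permutations and `J ↦ -J`, this yields every relation
that contains no elliptic integral.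

The second is integration. With `w = r - z₁ - z₂`, the Poisson kernel removes `z₃` and leaves `r² /
(|w|² - 1)`. Putting `z₁ = u z₂` makes the denominator affine in `Re ((1 + u) z₂)`, so the
`z₂`-average is elementary (`integral_unitExp_inv` and its first and second moments). What remains
is a function of `x = |1 + u|² = 4 cos² t`. A scaled tangent substitution puts it in Legendre form
with modulus `modParam r` (`innerAverage_tanScale`). Thus `c₀₀₀` is a multiple of `K`, while `c₁₀₀`
and `c₀₁₁` also involve a third-kind integral, and `c₀₁₁` involves `E`.

Since `c₁₀₀` is also known from the recurrence, `K`, `Π` and `c₀₀₀` satisfy a linear relation.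
Combining it with the integral for `c₀₁₁` gives the formula with characteristic `4 / (r - 1)²`
(`elliptic_relations`). The other formula follows from the addition relation for two characteristics
with product `m` (`ellipticPi_add_ellipticPi`). -/

open MeasureTheory Real Set Filter Topology
open scoped ComplexConjugate

/-! ### Averages over the unit circle -/

/-- The point `exp (2 π i θ)` of the unit circle, as a complex number. -/
noncomputable def unitExp (θ : UnitAddCircle) : ℂ := (AddCircle.toCircle θ : ℂ)

@[simp] theorem norm_unitExp (θ : UnitAddCircle) : ‖unitExp θ‖ = 1 := Circle.norm_coe _

@[fun_prop] theorem continuous_unitExp : Continuous unitExp := by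
  unfold unitExp; fun_prop

theorem unitExp_add (θ φ : UnitAddCircle) : unitExp (θ + φ) = unitExp θ * unitExp φ := by
  simp [unitExp, AddCircle.toCircle_add]

theorem unitExp_neg (θ : UnitAddCircle) : unitExp (-θ) = conj (unitExp θ) := by
  rw [unitExp, unitExp, AddCircle.toCircle_neg, Circle.coe_inv_eq_conj]

theorem unitExp_coe (x : ℝ) : unitExp (x : UnitAddCircle) = Complex.exp (2 * π * x * Complex.I) := by
  simp [unitExp, AddCircle.toCircle_apply_mk]

theorem integral_unitExp_eq_circleAverage {E : Type*} [NormedAddCommGroup E] [NormedSpace ℝ E]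
    (g : ℂ → E) :
    ∫ θ : UnitAddCircle, g (unitExp θ) ∂AddCircle.haarAddCircle
      = Real.circleAverage g 0 1 := by
  rw [AddCircle.integral_haarAddCircle, inv_one, one_smul,
    ← UnitAddCircle.intervalIntegral_preimage 0, Real.circleAverage_def]
  have h := intervalIntegral.integral_comp_mul_right (a := 0) (b := 1)
    (fun θ : ℝ => g (circleMap 0 1 θ)) (c := 2 * π) (by positivity)
  simp only [zero_mul, one_mul] at h
  rw [← h, zero_add]
  refine intervalIntegral.integral_congr fun θ _ => ?_
  simp [unitExp_coe, circleMap, mul_comm]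

theorem integral_unitExp_of_differentiable {F : ℂ → ℂ}
    (hF : ∀ z : ℂ, ‖z‖ ≤ 1 → DifferentiableAt ℂ F z) :
    ∫ θ : UnitAddCircle, F (unitExp θ) ∂AddCircle.haarAddCircle = F 0 := by
  rw [integral_unitExp_eq_circleAverage]
  refine DiffContOnCl.circleAverage ?_
  refine DifferentiableOn.diffContOnCl fun z hz => (hF z ?_).differentiableWithinAt
  simpa using (Metric.closure_ball_subset_closedBall hz)

theorem integral_unitExp_poisson {w : ℂ} (hw : ‖w‖ < 1) :
    ∫ θ : UnitAddCircle, (1 - ‖w‖ ^ 2) / ‖unitExp θ - w‖ ^ 2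
      ∂AddCircle.haarAddCircle = 1 := by
  have h := DiffContOnCl.circleAverage_poissonKernel_smul' (f := fun _ => (1 : ℂ)) (c := 0)
    (R := 1) (w := w) diffContOnCl_const (by simpa using hw)
  rw [← integral_unitExp_eq_circleAverage] at h
  simp only [sub_zero, norm_unitExp, one_pow, Complex.real_smul, mul_one] at h
  rw [← Complex.ofReal_inj, Complex.ofReal_one, ← h]
  exact (integral_ofReal (𝕜 := ℂ)).symm

theorem re_mul_unitExp_le (b : ℂ) (θ : UnitAddCircle) :
    (b * unitExp θ).re ≤ ‖b‖ :=
  (Complex.re_le_norm _).trans (by simp)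

/-- The denominator factors as `ρ |z - b̄/ρ|²` on the circle, so the integrand is `1/S` times the
Poisson kernel of the interior point `b̄/ρ`, which has mean one. -/
theorem integral_unitExp_inv {A : ℝ} {b : ℂ} (h : 2 * ‖b‖ < A) :
    ∫ θ : UnitAddCircle, 1 / (A - 2 * (b * unitExp θ).re)
      ∂AddCircle.haarAddCircle = 1 / √(A ^ 2 - 4 * ‖b‖ ^ 2) := by
  have hb := norm_nonneg b
  have hpos : 0 < A ^ 2 - 4 * ‖b‖ ^ 2 := by nlinarith
  set S := √(A ^ 2 - 4 * ‖b‖ ^ 2) with hS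
  have hS0 : 0 < S := Real.sqrt_pos.2 hpos
  have hS2 : S ^ 2 = A ^ 2 - 4 * ‖b‖ ^ 2 := Real.sq_sqrt hpos.le
  -- The larger root of `ρ² - Aρ + |b|² = 0`; choosing the larger one places `b̄/ρ` inside the disc.
  set ρ := (A + S) / 2 with hρ
  have hρ0 : 0 < ρ := by rw [hρ]; linarith
  have hρ2 : ρ ^ 2 + ‖b‖ ^ 2 = A * ρ := by rw [hρ]; nlinarith
  have hbρ : ‖b‖ < ρ := by rw [hρ]; linarith
  have hw : ‖conj b / (ρ : ℂ)‖ = ‖b‖ / ρ := by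
    simp [abs_of_pos hρ0]
  have hP := integral_unitExp_poisson (w := conj b / (ρ : ℂ))
    (by rw [hw, div_lt_one hρ0]; exact hbρ)
  rw [hw] at hP
  have key : ∀ θ : UnitAddCircle, 1 / (A - 2 * (b * unitExp θ).re) = 1 / S *
      ((1 - (‖b‖ / ρ) ^ 2) / ‖unitExp θ - conj b / (ρ : ℂ)‖ ^ 2) := by
    intro θ
    have h1 : ρ * ‖unitExp θ - conj b / (ρ : ℂ)‖ ^ 2
        = A - 2 * (b * unitExp θ).re := by
      rw [← Complex.normSq_eq_norm_sq, Complex.normSq_sub, Complex.normSq_eq_norm_sq,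
        Complex.normSq_eq_norm_sq, hw]
      have : unitExp θ * conj (conj b / (ρ : ℂ))
          = ((1 / ρ : ℝ) : ℂ) * (b * unitExp θ) := by
        simp; ring
      rw [this, Complex.re_ofReal_mul]
      simp only [norm_unitExp]
      field_simp
      linarith
    have h2 : (1 - (‖b‖ / ρ) ^ 2) * ρ = S := by
      have : S = 2 * ρ - A := by rw [hρ]; ring
      field_simp
      rw [this]
      linarith
    have h3 : 0 < A - 2 * (b * unitExp θ).re := by
      linarith [re_mul_unitExp_le b θ]
    rw [← h1] at h3 ⊢
    have h4 := pos_of_mul_pos_right h3 hρ0.le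
    rw [← h2] at hS0 ⊢
    have h5 := pos_of_mul_pos_left hS0 hρ0.le
    generalize 1 - (‖b‖ / ρ) ^ 2 = u at *
    field_simp
  simp_rw [key]
  rw [integral_const_mul, hP, mul_one]

theorem integrable_of_continuous_compactSpace {X E : Type*} [TopologicalSpace X] [CompactSpace X]
    [MeasurableSpace X] [BorelSpace X] [NormedAddCommGroup E] [SecondCountableTopologyEither X E]
    {μ : Measure X} [IsFiniteMeasure μ] {f : X → E} (hf : Continuous f) : Integrable f μ :=
  hf.integrable_of_hasCompactSupport (HasCompactSupport.of_compactSpace _)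

theorem integral_unitExp_re_of_differentiable {F : ℂ → ℂ} (hF : Differentiable ℂ F) :
    ∫ θ : UnitAddCircle, (F (unitExp θ)).re ∂AddCircle.haarAddCircle = (F 0).re := by
  rw [← integral_unitExp_of_differentiable fun z _ => hF z]
  exact integral_re (𝕜 := ℂ) (μ := AddCircle.haarAddCircle (T := (1 : ℝ)))
    (integrable_of_continuous_compactSpace (hF.continuous.comp continuous_unitExp))

section
variable {A : ℝ} {b : ℂ}

theorem den_unitExp_pos (h : 2 * ‖b‖ < A) (θ : UnitAddCircle) :
    0 < A - 2 * (b * unitExp θ).re := by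
  linarith [re_mul_unitExp_le b θ]

theorem continuous_inv_den (h : 2 * ‖b‖ < A) :
    Continuous fun θ : UnitAddCircle => 1 / (A - 2 * (b * unitExp θ).re) :=
  Continuous.div (by fun_prop) (by fun_prop) fun θ => (den_unitExp_pos h θ).ne'

theorem integral_unitExp_re_div (h : 2 * ‖b‖ < A) :
    ∫ θ : UnitAddCircle, (b * unitExp θ).re / (A - 2 * (b * unitExp θ).re)
      ∂AddCircle.haarAddCircle = (A * (1 / √(A ^ 2 - 4 * ‖b‖ ^ 2)) - 1) / 2 := by
  have key : ∀ θ : UnitAddCircle,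
      (b * unitExp θ).re / (A - 2 * (b * unitExp θ).re)
        = A / 2 * (1 / (A - 2 * (b * unitExp θ).re)) - 1 / 2 := by
    intro θ
    have h1 := (den_unitExp_pos h θ).ne'
    obtain ⟨d, hd⟩ : ∃ d, d = A - 2 * (b * unitExp θ).re := ⟨_, rfl⟩
    rw [← hd] at h1 ⊢
    rw [show (b * unitExp θ).re = (A - d) / 2 by linarith]
    field_simp
  simp_rw [key]
  rw [integral_sub ((integrable_of_continuous_compactSpace (continuous_inv_den h)).const_mul _)
    (integrable_const _), integral_const_mul, integral_unitExp_inv h]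
  simp
  ring

/-- Since `Re (v²) = 2 (Re v)² - |v|²`, polynomial division by `A - 2 Re v` leaves the constant
remainder `A²/2 - |b|²` and a quotient whose linear part averages to zero. -/
theorem integral_unitExp_re_sq_div (h : 2 * ‖b‖ < A) :
    ∫ θ : UnitAddCircle, ((b * unitExp θ) ^ 2).re /
        (A - 2 * (b * unitExp θ).re)
      ∂AddCircle.haarAddCircle
      = (A ^ 2 / 2 - ‖b‖ ^ 2) * (1 / √(A ^ 2 - 4 * ‖b‖ ^ 2)) - A / 2 := by
  have key : ∀ θ : UnitAddCircle,
      ((b * unitExp θ) ^ 2).re / (A - 2 * (b * unitExp θ).re)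
        = (A ^ 2 / 2 - ‖b‖ ^ 2) * (1 / (A - 2 * (b * unitExp θ).re))
          - (A / 2 + (b * unitExp θ).re) := by
    intro θ
    have h1 := (den_unitExp_pos h θ).ne'
    have h2 : ((b * unitExp θ) ^ 2).re
        = 2 * (b * unitExp θ).re ^ 2 - ‖b‖ ^ 2 := by
      have : ‖b‖ ^ 2 = ‖b * unitExp θ‖ ^ 2 := by simp
      rw [this, ← Complex.normSq_eq_norm_sq, Complex.normSq_apply, pow_two, Complex.mul_re]
      ring
    rw [h2]
    field_simp
    ring
  have hi : Integrable (fun θ : UnitAddCircle => (b * unitExp θ).re)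
      AddCircle.haarAddCircle := integrable_of_continuous_compactSpace (by fun_prop)
  simp_rw [key]
  rw [integral_sub ((integrable_of_continuous_compactSpace (continuous_inv_den h)).const_mul _)
    (by exact (integrable_const _).add hi), integral_const_mul, integral_unitExp_inv h,
    integral_add (integrable_const _) hi, integral_unitExp_re_of_differentiable (F := fun z => b * z) (by fun_prop)]
  simp

end

/-! ### The density on the torus and the symmetries of its Fourier coefficients -/

/-- The normalised Haar measure on the three-dimensional torus. -/
noncomputable abbrev torusMeasure : Measure (UnitAddTorus (Fin 3)) :=
  Measure.pi fun _ => AddCircle.haarAddCircle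

/-- The monomial `z₁^{j₁} z₂^{j₂} z₃^{j₃}` on the torus. -/
noncomputable def torusMonomial (J : Fin 3 → ℤ) (θ : UnitAddTorus (Fin 3)) : ℂ :=
  ∏ i, unitExp (θ i) ^ J i

/-- The density `1 / |p|²` as a real function on the torus. -/
noncomputable def torusDensity (r : ℝ) (θ : UnitAddTorus (Fin 3)) : ℝ :=
  1 / ‖pPoly r (fun i => unitExp (θ i))‖ ^ 2

theorem unitExp_ne_zero (θ : UnitAddCircle) : unitExp θ ≠ 0 := by
  rw [← norm_pos_iff, norm_unitExp]; exact one_pos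

theorem continuous_torusMonomial (J : Fin 3 → ℤ) : Continuous (torusMonomial J) := by
  unfold torusMonomial
  refine continuous_finsetProd _ fun i _ => ?_
  exact (continuous_unitExp.comp (continuous_apply i)).zpow₀ _ fun θ => Or.inl (unitExp_ne_zero _)

theorem norm_torusMonomial (J : Fin 3 → ℤ) (θ : UnitAddTorus (Fin 3)) :
    ‖torusMonomial J θ‖ = 1 := by
  simp [torusMonomial, norm_prod, norm_zpow]

theorem torusMonomial_neg (J : Fin 3 → ℤ) (θ : UnitAddTorus (Fin 3)) :
    torusMonomial (-J) θ = conj (torusMonomial J θ) := by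
  have h : torusMonomial (-J) θ = (torusMonomial J θ)⁻¹ := by
    simp [torusMonomial, Finset.prod_inv_distrib]
  rw [h, Complex.inv_def, Complex.normSq_eq_norm_sq, norm_torusMonomial]
  simp

theorem torusMonomial_add (I J : Fin 3 → ℤ) (θ : UnitAddTorus (Fin 3)) :
    torusMonomial (I + J) θ = torusMonomial I θ * torusMonomial J θ := by
  simp [torusMonomial, zpow_add₀ (unitExp_ne_zero _), Finset.prod_mul_distrib]

theorem pPoly_ne_zero {r : ℝ} (hr : 3 < r) {z : Fin 3 → ℂ} (hz : ∀ i, ‖z i‖ ≤ 1) :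
    pPoly r z ≠ 0 := by
  intro h
  have hr0 : (r : ℂ) ≠ 0 := by exact_mod_cast (by linarith : r ≠ 0)
  have h1 : z 0 + z 1 + z 2 = (r : ℂ) := by
    unfold pPoly at h
    field_simp at h
    linear_combination -h
  have h2 : ‖z 0 + z 1 + z 2‖ = r := by
    rw [h1, Complex.norm_real, Real.norm_of_nonneg (by linarith)]
  have h3 : ‖z 0 + z 1 + z 2‖ ≤ ‖z 0‖ + ‖z 1‖ + ‖z 2‖ := norm_add₃_le
  linarith [hz 0, hz 1, hz 2]

theorem pPoly_unitExp_ne_zero {r : ℝ} (hr : 3 < r) (θ : UnitAddTorus (Fin 3)) :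
    pPoly r (fun i => unitExp (θ i)) ≠ 0 :=
  pPoly_ne_zero hr fun _ => (norm_unitExp _).le

theorem continuous_pPoly_unitExp (r : ℝ) :
    Continuous fun θ : UnitAddTorus (Fin 3) => pPoly r (fun i => unitExp (θ i)) := by
  unfold pPoly; fun_prop

theorem continuous_torusDensity {r : ℝ} (hr : 3 < r) : Continuous (torusDensity r) :=
  continuous_const.div ((continuous_pPoly_unitExp r).norm.pow 2) fun θ =>
    pow_ne_zero _ (norm_ne_zero_iff.2 (pPoly_unitExp_ne_zero hr θ))

theorem fourierC_eq_integral (r : ℝ) (J : Fin 3 → ℤ) :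
    fourierC r J = ∫ θ, torusMonomial (-J) θ * (torusDensity r θ : ℂ) ∂torusMeasure := by
  have h : ∀ θ : UnitAddTorus (Fin 3),
      UnitAddTorus.mFourier (-J) θ • specDensity r θ
        = torusMonomial (-J) θ * (torusDensity r θ : ℂ) := by
    intro θ
    rw [smul_eq_mul]
    congr 1
    simp only [UnitAddTorus.mFourier, torusMonomial, ContinuousMap.coe_mk, fourier_apply,
      AddCircle.toCircle_zsmul, Circle.coe_zpow, unitExp]
  exact integral_congr_ae (Eventually.of_forall h)

theorem integrable_monomial_mul_density {r : ℝ} (hr : 3 < r) (J : Fin 3 → ℤ) :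
    Integrable (fun θ => torusMonomial J θ * (torusDensity r θ : ℂ)) torusMeasure :=
  integrable_of_continuous_compactSpace ((continuous_torusMonomial J).mul
    (Complex.continuous_ofReal.comp (continuous_torusDensity hr)))

theorem integral_torus_neg {E : Type*} [NormedAddCommGroup E] [NormedSpace ℝ E]
    (F : UnitAddTorus (Fin 3) → E) :
    ∫ θ, F (-θ) ∂torusMeasure = ∫ θ, F θ ∂torusMeasure :=
  haveI : (AddCircle.haarAddCircle : Measure UnitAddCircle).IsNegInvariant :=
    Measure.IsAddHaarMeasure.isNegInvariant_of_regular _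
  integral_neg_eq_self F torusMeasure

theorem integral_torus_perm {E : Type*} [NormedAddCommGroup E] [NormedSpace ℝ E]
    (σ : Equiv.Perm (Fin 3)) (F : UnitAddTorus (Fin 3) → E) :
    ∫ θ, F (fun i => θ (σ i)) ∂torusMeasure = ∫ θ, F θ ∂torusMeasure := by
  have h := measurePreserving_piCongrLeft (α := fun _ : Fin 3 => UnitAddCircle)
    (fun _ => AddCircle.haarAddCircle) σ.symm
  refine Eq.trans (integral_congr_ae (Eventually.of_forall fun θ => ?_)) (h.integral_comp' F)
  refine congrArg F (funext fun i => ?_)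
  simp [MeasurableEquiv.piCongrLeft, Equiv.piCongrLeft_apply]

theorem pPoly_perm (r : ℝ) (σ : Equiv.Perm (Fin 3)) (z : Fin 3 → ℂ) :
    pPoly r (fun i => z (σ i)) = pPoly r z := by
  have h := Equiv.sum_comp σ z
  simp only [Fin.sum_univ_three] at h
  simp only [pPoly, h]

theorem fourierC_perm (r : ℝ) (J : Fin 3 → ℤ) (σ : Equiv.Perm (Fin 3)) :
    fourierC r (fun i => J (σ i)) = fourierC r J := by
  rw [fourierC_eq_integral, fourierC_eq_integral, ← integral_torus_perm σ]
  refine integral_congr_ae (Eventually.of_forall fun θ => ?_)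
  simp only [torusDensity]
  rw [pPoly_perm r σ (fun i => unitExp (θ i))]
  congr 1
  exact Equiv.prod_comp σ (fun i => unitExp (θ i) ^ (-J) i)

theorem torusDensity_neg (r : ℝ) (θ : UnitAddTorus (Fin 3)) :
    torusDensity r (-θ) = torusDensity r θ := by
  have h : pPoly r (fun i => unitExp ((-θ) i)) = conj (pPoly r (fun i => unitExp (θ i))) := by
    simp [pPoly, unitExp_neg]
  rw [torusDensity, torusDensity, h, RCLike.norm_conj]

theorem fourierC_neg (r : ℝ) (J : Fin 3 → ℤ) : fourierC r (-J) = fourierC r J := by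
  rw [fourierC_eq_integral, fourierC_eq_integral, ← integral_torus_neg]
  refine integral_congr_ae (Eventually.of_forall fun θ => ?_)
  simp only [torusDensity_neg]
  congr 1
  simp only [torusMonomial, Pi.neg_apply, unitExp_neg, neg_neg]
  refine Finset.prod_congr rfl fun i _ => ?_
  rw [← Complex.inv_eq_conj (norm_unitExp _), zpow_neg, inv_zpow]

/-! ### Holomorphy of `1 / p` and the linear recurrence -/

/-- Mean value property on the torus, for functions holomorphic along complex lines. -/
theorem integral_torus_of_differentiable {F : (Fin 3 → ℂ) → ℂ}
    (hc : Continuous fun θ : UnitAddTorus (Fin 3) => F (fun i => unitExp (θ i)))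
    (hF : ∀ z : Fin 3 → ℂ, (∀ i, ‖z i‖ = 1) → ∀ w : ℂ, ‖w‖ ≤ 1 →
      DifferentiableAt ℂ (fun w : ℂ => F (fun i => w * z i)) w) :
    ∫ θ, F (fun i => unitExp (θ i)) ∂torusMeasure = F 0 := by
  set μ : Measure UnitAddCircle := AddCircle.haarAddCircle
  -- Haar measure is invariant under the diagonal rotation by `φ`. Averaging over `φ` as well and
  -- swapping the integrals reduces the claim to the one-variable mean value property on each disc
  -- `w ↦ w z`.
  have hshift : ∀ φ : UnitAddCircle,
      ∫ θ, F (fun i => unitExp φ * unitExp (θ i)) ∂torusMeasure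
        = ∫ θ, F (fun i => unitExp (θ i)) ∂torusMeasure := by
    intro φ
    rw [← integral_add_left_eq_self (μ := torusMeasure)
      (fun θ : UnitAddTorus (Fin 3) => F (fun i => unitExp (θ i))) (fun _ => φ)]
    simp only [Pi.add_apply, unitExp_add]
  have hcont : Continuous fun q : UnitAddCircle × UnitAddTorus (Fin 3) =>
      F (fun i => unitExp q.1 * unitExp (q.2 i)) := by
    have : Continuous fun q : UnitAddCircle × UnitAddTorus (Fin 3) =>
      (fun i => q.1 + q.2 i : UnitAddTorus (Fin 3)) := by fun_prop
    have h := hc.comp this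
    simpa only [Function.comp_def, unitExp_add] using h
  have hint : Integrable (fun q : UnitAddCircle × UnitAddTorus (Fin 3) =>
      F (fun i => unitExp q.1 * unitExp (q.2 i))) (μ.prod torusMeasure) :=
    integrable_of_continuous_compactSpace hcont
  have hswap := integral_integral_swap (f := fun (φ : UnitAddCircle)
    (θ : UnitAddTorus (Fin 3)) => F (fun i => unitExp φ * unitExp (θ i))) hint
  simp only [hshift] at hswap
  have hmean : ∀ θ : UnitAddTorus (Fin 3), ∫ φ, F (fun i => unitExp φ * unitExp (θ i)) ∂μ = F 0 := by
    intro θ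
    have h := integral_unitExp_of_differentiable
      (F := fun w : ℂ => F (fun i => w * unitExp (θ i)))
      (fun w hw => hF _ (fun i => norm_unitExp _) w hw)
    simp only [zero_mul] at h
    exact h
  simp only [hmean] at hswap
  simpa using hswap

/-- The Fourier coefficients of `1 / p̄` at nonnegative indices. -/
theorem integral_torus_monomial_div_pPoly {r : ℝ} (hr : 3 < r) (J : Fin 3 → ℕ) :
    ∫ θ, (∏ i, unitExp (θ i) ^ J i) / pPoly r (fun i => unitExp (θ i)) ∂torusMeasure
      = if J = 0 then 1 else 0 := by
  rw [integral_torus_of_differentiable (F := fun z => (∏ i, z i ^ J i) / pPoly r z)]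
  · split_ifs with h
    · simp [h, pPoly]
    · obtain ⟨i, hi⟩ := Function.ne_iff.1 h
      rw [Finset.prod_eq_zero (Finset.mem_univ i), zero_div]
      simpa using hi
  · refine Continuous.div (by fun_prop) (continuous_pPoly_unitExp r) (pPoly_unitExp_ne_zero hr)
  · intro z hz w hw
    refine DifferentiableAt.div (by fun_prop) (by unfold pPoly; fun_prop)
      (pPoly_ne_zero hr fun i => ?_)
    rw [norm_mul, hz i, mul_one]
    exact hw

/-- The left side is the integral of `z^{-J} p / |p|²`, that is, of the conjugate of `z^J / p`. The
latter is holomorphic for `J ≥ 0`, so its mean is its value at the origin. -/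
theorem fourierC_recurrence {r : ℝ} (hr : 3 < r) (J : Fin 3 → ℕ) :
    fourierC r (fun i => (J i : ℤ)) - (1 / (r : ℂ)) *
      ∑ k, fourierC r ((fun i => (J i : ℤ)) - Pi.single k 1) = if J = 0 then 1 else 0 := by
  have hconj : ∫ θ, conj ((∏ i, unitExp (θ i) ^ J i) / pPoly r (fun i => unitExp (θ i)))
      ∂torusMeasure = if J = 0 then 1 else 0 := by
    rw [integral_conj, integral_torus_monomial_div_pPoly hr]
    split_ifs <;> simp
  rw [← hconj]
  simp only [fourierC_eq_integral]
  rw [← integral_finsetSum _ fun k _ => integrable_monomial_mul_density hr _,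
    ← integral_const_mul, ← integral_sub (integrable_monomial_mul_density hr _)
      ((integrable_finsetSum _ fun k _ => integrable_monomial_mul_density hr _).const_mul _)]
  refine integral_congr_ae (Eventually.of_forall fun θ => ?_)
  have hp := pPoly_unitExp_ne_zero hr θ
  have hmon : ∏ i, unitExp (θ i) ^ J i = torusMonomial (fun i => (J i : ℤ)) θ := by
    simp [torusMonomial]
  have hsingle : ∀ k, torusMonomial (-((fun i => (J i : ℤ)) - Pi.single k 1)) θ
      = torusMonomial (-(fun i => (J i : ℤ))) θ * unitExp (θ k) := by
    intro k
    rw [neg_sub, sub_eq_add_neg, add_comm, torusMonomial_add]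
    congr 1
    rw [torusMonomial, Finset.prod_eq_single k]
    · simp
    · intro i _ hik
      simp [Pi.single_eq_of_ne hik]
    · simp
  have hD : (torusDensity r θ : ℂ) = 1 / (pPoly r (fun i => unitExp (θ i)) *
      conj (pPoly r (fun i => unitExp (θ i)))) := by
    rw [Complex.mul_conj, Complex.normSq_eq_norm_sq, torusDensity]
    push_cast
    rfl
  have hpc : conj (pPoly r (fun i => unitExp (θ i))) ≠ 0 := by simpa using hp
  simp only [hsingle, hmon, map_div₀, ← torusMonomial_neg]
  rw [hD, ← Finset.sum_mul, ← Finset.mul_sum, Fin.sum_univ_three]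
  have hp' : pPoly r (fun i => unitExp (θ i))
    = 1 - 1 / r * (unitExp (θ 0) + unitExp (θ 1) + unitExp (θ 2)) := by
    unfold pPoly; ring
  generalize torusMonomial (-(fun i => (J i : ℤ))) θ = m
  generalize conj (pPoly r (fun i => unitExp (θ i))) = q at *
  field_simp
  rw [hp']
  ring

/-! ### Reduction of the triple integral to a single angle -/

theorem integral_pi_haarAddCircle_succ {E : Type*} [NormedAddCommGroup E] [NormedSpace ℝ E]
    {n : ℕ} {F : UnitAddTorus (Fin (n + 1)) → E} (hF : Continuous F) :
    ∫ θ, F θ ∂(Measure.pi fun _ => AddCircle.haarAddCircle)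
      = ∫ a : UnitAddCircle, ∫ g : UnitAddTorus (Fin n), F (Fin.cons a g)
        ∂(Measure.pi fun _ => AddCircle.haarAddCircle) ∂AddCircle.haarAddCircle := by
  have h := (measurePreserving_piFinSuccAbove (α := fun _ : Fin (n + 1) => UnitAddCircle)
    (fun _ => AddCircle.haarAddCircle) 0).symm
  rw [← h.integral_comp']
  have hcont : Continuous fun q : UnitAddCircle × UnitAddTorus (Fin n) =>
      F (Fin.cons q.1 q.2) := hF.comp (by fun_prop)
  have hint := integrable_of_continuous_compactSpace (μ := Measure.prod
    (AddCircle.haarAddCircle (T := (1 : ℝ)))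
    (Measure.pi fun _ : Fin n => AddCircle.haarAddCircle (T := (1 : ℝ)))) hcont
  rw [← integral_prod _ hint]
  refine integral_congr_ae (Eventually.of_forall fun q => ?_)
  simp [MeasurableEquiv.piFinSuccAbove, Fin.insertNthEquiv]

theorem integral_torus_eq_iterated {E : Type*} [NormedAddCommGroup E] [NormedSpace ℝ E]
    [CompleteSpace E]
    {F : UnitAddTorus (Fin 3) → E} (hF : Continuous F) :
    ∫ θ, F θ ∂torusMeasure = ∫ a : UnitAddCircle, ∫ b : UnitAddCircle, ∫ c : UnitAddCircle,
      F ![a, b, c] ∂AddCircle.haarAddCircle ∂AddCircle.haarAddCircle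
        ∂AddCircle.haarAddCircle := by
  rw [integral_pi_haarAddCircle_succ hF]
  refine integral_congr_ae (Eventually.of_forall fun a => ?_)
  have h1 : Continuous fun g : UnitAddTorus (Fin 2) =>
    F (Fin.cons a g : Fin 3 → UnitAddCircle) := hF.comp (by fun_prop)
  refine (integral_pi_haarAddCircle_succ h1).trans ?_
  refine integral_congr_ae (Eventually.of_forall fun b => ?_)
  have h2 : Continuous fun g : UnitAddTorus (Fin 1) =>
    F (Fin.cons a (Fin.cons b g : Fin 2 → UnitAddCircle) : Fin 3 → UnitAddCircle) :=
    h1.comp (by fun_prop)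
  refine (integral_pi_haarAddCircle_succ h2).trans ?_
  refine integral_congr_ae (Eventually.of_forall fun c => ?_)
  have h3 : ∀ g : UnitAddTorus (Fin 0), (Fin.cons a (Fin.cons b (Fin.cons c g :
      Fin 1 → UnitAddCircle) : Fin 2 → UnitAddCircle) : Fin 3 → UnitAddCircle) = ![a, b, c] :=
    fun g => by rw [Subsingleton.elim g ![]]; rfl
  simp only [h3]
  rw [integral_const, probReal_univ, one_smul]

/-- Averaging `c_J` with the equal coefficient `c_{-J}` replaces the monomial by its real part. -/
theorem fourierC_eq_ofReal {r : ℝ} (hr : 3 < r) (J : Fin 3 → ℤ) :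
    fourierC r J = ((∫ θ, (torusMonomial J θ).re * torusDensity r θ ∂torusMeasure : ℝ) : ℂ) := by
  have h1 : fourierC r J = (fourierC r J + fourierC r (-J)) / 2 := by
    rw [fourierC_neg]; ring
  rw [h1, fourierC_eq_integral, fourierC_eq_integral, neg_neg,
    ← integral_add (integrable_monomial_mul_density hr _) (integrable_monomial_mul_density hr _),
    ← integral_div]
  refine Eq.trans (integral_congr_ae (Eventually.of_forall fun θ => ?_)) integral_ofReal
  simp only [torusMonomial_neg]
  rw [← add_mul, add_comm, Complex.add_conj]
  push_cast
  ring_nf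
  rfl

/-- Here `|w| > 1` for `w = r - z₁ - z₂`, and the square root in `integral_unitExp_inv` collapses
because `(|w|² + 1)² - 4|w|²` is a perfect square. -/
theorem integral_torusDensity_third {r : ℝ} (hr : 3 < r) (a b : UnitAddCircle) :
    ∫ c, torusDensity r ![a, b, c] ∂AddCircle.haarAddCircle
      = r ^ 2 / (‖(r : ℂ) - unitExp a - unitExp b‖ ^ 2 - 1) := by
  have hr0 : (r : ℂ) ≠ 0 := by exact_mod_cast (by linarith : r ≠ 0)
  set w : ℂ := (r : ℂ) - unitExp a - unitExp b with hw
  have hw1 : 1 < ‖w‖ := by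
    have h1 : ‖(r : ℂ)‖ ≤ ‖w‖ + ‖unitExp a‖ + ‖unitExp b‖ := by
      have : (r : ℂ) = w + unitExp a + unitExp b := by rw [hw]; ring
      conv_lhs => rw [this]
      exact norm_add₃_le
    rw [Complex.norm_real, Real.norm_of_nonneg (by linarith), norm_unitExp, norm_unitExp] at h1
    linarith
  have key : ∀ c, torusDensity r ![a, b, c]
      = r ^ 2 * (1 / ((‖w‖ ^ 2 + 1) - 2 * (conj w * unitExp c).re)) := by
    intro c
    have h1 : pPoly r (fun i => unitExp (![a, b, c] i)) = (w - unitExp c) / r := by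
      simp only [pPoly, Matrix.cons_val]
      rw [hw]
      field_simp
      ring
    have h2 : ‖w - unitExp c‖ ^ 2 = (‖w‖ ^ 2 + 1) - 2 * (conj w * unitExp c).re := by
      rw [← Complex.normSq_eq_norm_sq, Complex.normSq_sub, Complex.normSq_eq_norm_sq,
        Complex.normSq_eq_norm_sq, norm_unitExp]
      simp
    rw [torusDensity, h1, norm_div, div_pow, h2, Complex.norm_real, Real.norm_eq_abs, sq_abs,
      one_div_div, mul_one_div]
  have hlt : 2 * ‖conj w‖ < ‖w‖ ^ 2 + 1 := by
    rw [RCLike.norm_conj]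
    nlinarith [sq_pos_of_pos (sub_pos.2 hw1)]
  simp_rw [key]
  rw [integral_const_mul, integral_unitExp_inv hlt, RCLike.norm_conj,
    show (‖w‖ ^ 2 + 1) ^ 2 - 4 * ‖w‖ ^ 2 = (‖w‖ ^ 2 - 1) ^ 2 by ring,
    Real.sqrt_sq (by nlinarith), mul_one_div]

/-- The change of variables `z₁ = u z₂`, after which `z₁ + z₂ = (1 + u) z₂` and only the phase of
`z₂` is coupled to `r`. -/
theorem integral_integral_shear {G : UnitAddCircle → UnitAddCircle → ℝ}
    (hG : Continuous (Function.uncurry G)) :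
    ∫ a, ∫ b, G a b ∂AddCircle.haarAddCircle ∂AddCircle.haarAddCircle
      = ∫ a, ∫ b, G (a + b) b ∂AddCircle.haarAddCircle ∂AddCircle.haarAddCircle := by
  have h2 : Continuous (Function.uncurry fun a b => G (a + b) b) := by
    have : Continuous fun q : UnitAddCircle × UnitAddCircle => (q.1 + q.2, q.2) := by fun_prop
    exact hG.comp this
  rw [integral_integral_swap (integrable_of_continuous_compactSpace hG),
    integral_integral_swap (integrable_of_continuous_compactSpace h2)]
  refine integral_congr_ae (Eventually.of_forall fun b => ?_)
  exact (integral_add_right_eq_self (fun a => G a b) b).symm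

theorem norm_one_add_unitExp_le (a : UnitAddCircle) : ‖1 + unitExp a‖ ≤ 2 := by
  have := norm_add_le (1 : ℂ) (unitExp a)
  rw [norm_one, norm_unitExp] at this
  linarith

/-- With `y = |1 + u| ≤ 2` the difference of the two sides is `(r - y)² - 1`, positive since `r - y
> 1`. This is the hypothesis needed to average over `z₂`. -/
theorem two_mul_norm_lt {r : ℝ} (hr : 3 < r) (a : UnitAddCircle) :
    2 * ‖(r : ℂ) * (1 + unitExp a)‖ < r ^ 2 - 1 + ‖1 + unitExp a‖ ^ 2 := by
  rw [norm_mul, Complex.norm_real, Real.norm_of_nonneg (by linarith)]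
  nlinarith [norm_one_add_unitExp_le a]

theorem continuous_unitExp_zpow (k : ℤ) : Continuous fun θ : UnitAddCircle => unitExp θ ^ k :=
  continuous_unitExp.zpow₀ _ fun θ => Or.inl (unitExp_ne_zero θ)

theorem integrable_integral_re_zpow_div {r : ℝ} (hr : 3 < r) (i j : ℤ) :
    Integrable (fun a => ∫ b, (unitExp a ^ i * unitExp b ^ j).re /
        ((r ^ 2 - 1 + ‖1 + unitExp a‖ ^ 2) - 2 * ((r : ℂ) * (1 + unitExp a) * unitExp b).re)
      ∂(AddCircle.haarAddCircle : Measure UnitAddCircle)) AddCircle.haarAddCircle := by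
  have h : Continuous fun q : UnitAddCircle × UnitAddCircle =>
      (unitExp q.1 ^ i * unitExp q.2 ^ j).re / ((r ^ 2 - 1 + ‖1 + unitExp q.1‖ ^ 2)
        - 2 * ((r : ℂ) * (1 + unitExp q.1) * unitExp q.2).re) := by
    refine Continuous.div ?_ (by fun_prop) fun q =>
      (den_unitExp_pos (two_mul_norm_lt hr _) _).ne'
    exact Complex.continuous_re.comp (((continuous_unitExp_zpow i).comp continuous_fst).mul
      ((continuous_unitExp_zpow j).comp continuous_snd))
  exact (integrable_of_continuous_compactSpace h).integral_prod_left

theorem fourierC_eq_integral_integral {r : ℝ} (hr : 3 < r) (i j : ℤ) :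
    fourierC r ![i, j, 0] = ((r ^ 2 * ∫ a, ∫ b,
      (unitExp a ^ i * unitExp b ^ (i + j)).re /
        ((r ^ 2 - 1 + ‖1 + unitExp a‖ ^ 2) - 2 * ((r : ℂ) * (1 + unitExp a) * unitExp b).re)
      ∂AddCircle.haarAddCircle ∂AddCircle.haarAddCircle : ℝ) : ℂ) := by
  have hmon : ∀ a b c, torusMonomial ![i, j, 0] ![a, b, c] = unitExp a ^ i * unitExp b ^ j := by
    intro a b c
    simp [torusMonomial, Fin.prod_univ_three]
  have hnorm : ∀ a b : UnitAddCircle, ‖(r : ℂ) - unitExp (a + b) - unitExp b‖ ^ 2 - 1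
      = (r ^ 2 - 1 + ‖1 + unitExp a‖ ^ 2)
        - 2 * ((r : ℂ) * (1 + unitExp a) * unitExp b).re := by
    intro a b
    have h1 : (r : ℂ) - unitExp (a + b) - unitExp b = r - (1 + unitExp a) * unitExp b := by
      rw [unitExp_add]; ring
    rw [h1, ← Complex.normSq_eq_norm_sq, Complex.normSq_sub, Complex.normSq_eq_norm_sq,
      Complex.normSq_eq_norm_sq, norm_mul, norm_unitExp, Complex.re_ofReal_mul, mul_assoc,
      Complex.re_ofReal_mul, Complex.conj_re, Complex.norm_real, Real.norm_eq_abs, sq_abs]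
    ring
  have hG : Continuous (Function.uncurry fun a b : UnitAddCircle =>
      (unitExp a ^ i * unitExp b ^ j).re * (r ^ 2 / (‖(r : ℂ) - unitExp a - unitExp b‖ ^ 2 - 1))) := by
    refine Continuous.mul ?_ (Continuous.div (by fun_prop) (by fun_prop) fun q => ?_)
    · exact Complex.continuous_re.comp
        (((continuous_unitExp_zpow i).comp continuous_fst).mul
          ((continuous_unitExp_zpow j).comp continuous_snd))
    · have h := hnorm (q.1 - q.2) q.2
      rw [sub_add_cancel] at h
      rw [h]
      exact (den_unitExp_pos (two_mul_norm_lt hr _) _).ne'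
  rw [fourierC_eq_ofReal hr, integral_torus_eq_iterated
    (by exact (Complex.continuous_re.comp (continuous_torusMonomial _)).mul (continuous_torusDensity hr))]
  simp only [hmon, integral_const_mul, integral_torusDensity_third hr]
  rw [integral_integral_shear hG, ← integral_const_mul]
  congr 1
  refine integral_congr_ae (Eventually.of_forall fun a => ?_)
  dsimp only
  rw [← integral_const_mul]
  refine integral_congr_ae (Eventually.of_forall fun b => ?_)
  dsimp only
  rw [hnorm, unitExp_add, mul_zpow, mul_assoc, ← zpow_add₀ (unitExp_ne_zero _)]
  ring

/-- The inner average of `1 / (|r - z₁ - z₂|² - 1)`, as a function of `x = |1 + z₁ / z₂|²`. -/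
noncomputable def innerAverage (r x : ℝ) : ℝ := 1 / √(((r - 1) ^ 2 - x) * ((r + 1) ^ 2 - x))

theorem innerAverage_eq (r : ℝ) (a : UnitAddCircle) :
    1 / √((r ^ 2 - 1 + ‖1 + unitExp a‖ ^ 2) ^ 2 - 4 * ‖(r : ℂ) * (1 + unitExp a)‖ ^ 2)
      = innerAverage r (‖1 + unitExp a‖ ^ 2) := by
  rw [innerAverage, norm_mul, mul_pow, Complex.norm_real, Real.norm_eq_abs, sq_abs]
  congr 2
  ring

theorem fourierC_zero_eq {r : ℝ} (hr : 3 < r) :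
    fourierC r ![0, 0, 0] = ((r ^ 2 * ∫ a, innerAverage r (‖1 + unitExp a‖ ^ 2)
      ∂AddCircle.haarAddCircle : ℝ) : ℂ) := by
  rw [fourierC_eq_integral_integral hr]
  simp only [zpow_zero, add_zero, mul_one, Complex.one_re]
  congr 2
  refine integral_congr_ae (Eventually.of_forall fun a => ?_)
  dsimp only
  rw [integral_unitExp_inv (two_mul_norm_lt hr a), innerAverage_eq]

/-- Neither `z₁` nor `z₂` alone is a multiple of `(1 + u) z₂`, but their sum is. Averaging `c₁₀₀`
with `c₀₁₀` therefore gives the first moment `integral_unitExp_re_div`. -/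
theorem fourierC_one_eq {r : ℝ} (hr : 3 < r) :
    fourierC r ![1, 0, 0] = ((r / 4 * ∫ a, ((r ^ 2 - 1 + ‖1 + unitExp a‖ ^ 2) *
      innerAverage r (‖1 + unitExp a‖ ^ 2) - 1) ∂AddCircle.haarAddCircle : ℝ) : ℂ) := by
  have hsymm : fourierC r ![1, 0, 0] = fourierC r ![0, 1, 0] := by
    rw [← fourierC_perm r ![1, 0, 0] (Equiv.swap 0 1)]
    congr 1
    ext i
    fin_cases i <;> rfl
  have h2 : fourierC r ![1, 0, 0] = (fourierC r ![1, 0, 0] + fourierC r ![0, 1, 0]) / 2 := by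
    rw [← hsymm]; ring
  rw [h2, fourierC_eq_integral_integral hr, fourierC_eq_integral_integral hr, ← Complex.ofReal_add,
    ← mul_add, ← integral_add (integrable_integral_re_zpow_div hr _ _)
      (integrable_integral_re_zpow_div hr _ _)]
  rw [← Complex.ofReal_ofNat, ← Complex.ofReal_div, Complex.ofReal_inj, mul_div_right_comm, show r ^ 2 / 2 = r / 4 * (2 * r) by ring, mul_assoc,
    ← integral_const_mul]
  congr 1
  refine integral_congr_ae (Eventually.of_forall fun a => ?_)
  have hM := integral_unitExp_re_div (two_mul_norm_lt hr a)
  rw [innerAverage_eq] at hM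
  have hint : ∀ i j : ℤ, Integrable (fun b => (unitExp a ^ i * unitExp b ^ j).re /
        ((r ^ 2 - 1 + ‖1 + unitExp a‖ ^ 2) - 2 * ((r : ℂ) * (1 + unitExp a) * unitExp b).re))
      (AddCircle.haarAddCircle : Measure UnitAddCircle) := fun i j => by
    refine integrable_of_continuous_compactSpace (Continuous.div ?_ (by fun_prop) fun b =>
      (den_unitExp_pos (two_mul_norm_lt hr a) b).ne')
    exact Complex.continuous_re.comp (continuous_const.mul (continuous_unitExp_zpow j))
  dsimp only
  rw [← integral_add (hint 1 (1 + 0)) (hint 0 (0 + 1)), ← integral_const_mul,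
    ← mul_div_cancel₀ (_ * innerAverage r _ - 1) (two_ne_zero' ℝ), ← hM, ← integral_const_mul]
  refine integral_congr_ae (Eventually.of_forall fun b => ?_)
  have hre : ((r : ℂ) * (1 + unitExp a) * unitExp b).re
      = r * (unitExp b).re + r * (unitExp a * unitExp b).re := by
    rw [show (r : ℂ) * (1 + unitExp a) * unitExp b
      = r * unitExp b + r * (unitExp a * unitExp b) by ring, Complex.add_re,
      Complex.re_ofReal_mul, Complex.re_ofReal_mul]
  simp only [add_zero, zero_add, zpow_one, zpow_zero, one_mul]
  nth_rewrite 3 [hre]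
  ring

/-- The inner average of `Re (z₁ z₂) r² / (|r - z₁ - z₂|² - 1)`, as a function of
`x = |1 + z₁ / z₂|²`. -/
noncomputable def innerAverageOneOne (r x : ℝ) : ℝ :=
  if x = 0 then 0 else
    (r ^ 2 - 1) ^ 2 / (2 * x) * (innerAverage r x - 1 / (r ^ 2 - 1)) - innerAverage r x
      + x / 2 * innerAverage r x - 1 / 2

/-- On the circle `(1 + u)² = |1 + u|² u`, so `z₁ z₂ = u z₂²` is the square of `r (1 + u) z₂`
divided by `r² x`, and the second moment applies. Its value is grouped so that the factor
multiplying `1/x` vanishes at `x = 0`. -/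
theorem fourierC_one_one_eq {r : ℝ} (hr : 3 < r) :
    fourierC r ![0, 1, 1] = ((∫ a, innerAverageOneOne r (‖1 + unitExp a‖ ^ 2)
      ∂AddCircle.haarAddCircle : ℝ) : ℂ) := by
  have hr0 : r ≠ 0 := by linarith
  have hsymm : fourierC r ![0, 1, 1] = fourierC r ![1, 1, 0] := by
    rw [← fourierC_perm r ![0, 1, 1] (Equiv.swap 0 2)]
    congr 1
    ext i
    fin_cases i <;> rfl
  rw [hsymm, fourierC_eq_integral_integral hr, ← integral_const_mul]
  congr 1
  refine integral_congr_ae (Eventually.of_forall fun a => ?_)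
  have hsq : (1 + unitExp a) ^ 2 = ((‖1 + unitExp a‖ ^ 2 : ℝ) : ℂ) * unitExp a := by
    have h1 : conj (unitExp a) * unitExp a = 1 := by
      rw [← Complex.inv_eq_conj (norm_unitExp a), inv_mul_cancel₀ (unitExp_ne_zero a)]
    rw [← Complex.normSq_eq_norm_sq, ← Complex.mul_conj, map_add, map_one]
    linear_combination (-(1 + unitExp a)) * h1
  have hrz : ∀ b, ((r : ℂ) * (1 + unitExp a) * unitExp b) ^ 2
      = ((r ^ 2 * ‖1 + unitExp a‖ ^ 2 : ℝ) : ℂ) * (unitExp a * unitExp b ^ 2) := by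
    intro b
    rw [mul_pow, mul_pow, hsq]
    push_cast
    ring
  have hM := integral_unitExp_re_sq_div (two_mul_norm_lt hr a)
  rw [innerAverage_eq] at hM
  simp only [hrz, Complex.re_ofReal_mul, mul_div_assoc] at hM
  rw [integral_const_mul] at hM
  simp only [zpow_one, show (1 : ℤ) + 1 = 2 by norm_num]
  norm_cast
  rw [innerAverageOneOne]
  split_ifs with hx
  -- Division by `x` is impossible here, but the denominator is constant and `u z₂²` has mean zero,
  -- which is the value assigned at `x = 0`.
  · have h0 : 1 + unitExp a = 0 := by simpa using hx
    simp only [h0, norm_zero, mul_zero, zero_mul, Complex.zero_re, sub_zero]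
    rw [integral_div, integral_unitExp_re_of_differentiable (F := fun z => unitExp a * z ^ 2)
      (by fun_prop)]
    simp
  · have hn : ‖(r : ℂ) * (1 + unitExp a)‖ ^ 2 = r ^ 2 * ‖1 + unitExp a‖ ^ 2 := by
      rw [norm_mul, mul_pow, Complex.norm_real, Real.norm_eq_abs, sq_abs]
    rw [hn] at hM
    have h1 : r ^ 2 - 1 ≠ 0 := by nlinarith
    rw [← mul_right_inj' hx, ← mul_assoc, mul_comm _ (r ^ 2), hM]
    generalize ‖1 + unitExp a‖ ^ 2 = x at hx
    field_simp
    ring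

/-! ### Tangent substitutions -/

theorem image_arctan_Ioi_zero : arctan '' Ioi 0 = Ioo 0 (π / 2) := by
  ext t
  constructor
  · rintro ⟨s, hs, rfl⟩
    exact ⟨arctan_pos.2 hs, arctan_lt_pi_div_two s⟩
  · rintro ⟨h0, h1⟩
    exact ⟨tan t, tan_pos_of_pos_of_lt_pi_div_two h0 h1, arctan_tan (by linarith) h1⟩

theorem integral_zero_pi_div_two_eq (g : ℝ → ℝ) :
    ∫ t in (0 : ℝ)..π / 2, g t = ∫ s in Ioi 0, g (arctan s) / (1 + s ^ 2) := by
  rw [intervalIntegral.integral_of_le (by positivity), integral_Ioc_eq_integral_Ioo,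
    ← image_arctan_Ioi_zero, integral_image_eq_integral_abs_deriv_smul measurableSet_Ioi
      (fun s _ => (hasDerivAt_arctan s).hasDerivWithinAt) arctan_injective.injOn]
  refine setIntegral_congr_fun measurableSet_Ioi fun s _ => ?_
  simp only [smul_eq_mul]
  rw [abs_of_pos (by positivity)]
  ring

theorem norm_one_add_unitExp_sq (x : ℝ) :
    ‖1 + unitExp (x : UnitAddCircle)‖ ^ 2 = 4 * cos (π * x) ^ 2 := by
  rw [unitExp_coe, ← Complex.normSq_eq_norm_sq, Complex.normSq_apply]
  have h : Complex.exp (2 * π * x * Complex.I)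
      = ((cos (2 * (π * x)) : ℝ) : ℂ) + ((sin (2 * (π * x)) : ℝ) : ℂ) * Complex.I := by
    rw [Complex.ofReal_cos, Complex.ofReal_sin, ← Complex.exp_mul_I]
    push_cast
    ring_nf
  rw [h]
  simp only [Complex.add_re, Complex.add_im, Complex.one_re, Complex.one_im, Complex.ofReal_re,
    Complex.ofReal_im, Complex.mul_re, Complex.mul_im, Complex.I_re, Complex.I_im]
  have h1 := sin_sq_add_cos_sq (2 * (π * x))
  have h2 := cos_two_mul (π * x)
  nlinarith

theorem integral_unitExp_norm_one_add (H : ℝ → ℝ) :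
    ∫ a, H (‖1 + unitExp a‖ ^ 2) ∂AddCircle.haarAddCircle
      = 2 / π * ∫ s in Ioi 0, H (4 / (1 + s ^ 2)) / (1 + s ^ 2) := by
  rw [AddCircle.integral_haarAddCircle, inv_one, one_smul,
    -- Starting the period at `-1/2` makes `t = π x` run over `(-π/2, π/2)`, the range of `arctan`;
    -- evenness then folds the line onto the half-line.
    ← UnitAddCircle.intervalIntegral_preimage (-(1 / 2))]
  simp only [norm_one_add_unitExp_sq]
  have h := intervalIntegral.integral_comp_mul_left (a := -(1 / 2)) (b := -(1 / 2) + 1)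
    (fun t : ℝ => H (4 * cos t ^ 2)) (c := π) (by positivity)
  rw [h, show π * -(1 / 2) = -(π / 2) by ring, show π * (-(1 / 2) + 1) = π / 2 by ring,
    intervalIntegral.integral_of_le (by linarith [pi_pos]), integral_Ioc_eq_integral_Ioo,
    ← range_arctan, ← image_univ, integral_image_eq_integral_abs_deriv_smul MeasurableSet.univ
      (fun s _ => (hasDerivAt_arctan s).hasDerivWithinAt) arctan_injective.injOn,
    setIntegral_univ, div_mul_eq_mul_div, ← integral_comp_abs, smul_eq_mul, inv_mul_eq_div]
  congr 1
  refine integral_congr_ae (Eventually.of_forall fun s => ?_)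
  simp only [smul_eq_mul, cos_sq_arctan, sq_abs]
  rw [abs_of_pos (by positivity)]
  ring_nf

/-! ### Complete elliptic integrals in the tangent variable -/

section Legendre
variable {m : ℝ}

theorem one_sub_mul_sin_arctan_sq (n s : ℝ) :
    1 - n * sin (arctan s) ^ 2 = (1 + (1 - n) * s ^ 2) / (1 + s ^ 2) := by
  rw [sin_sq_arctan]
  have : 1 + s ^ 2 ≠ 0 := by positivity
  field_simp
  ring

/-- The integrand of `K(m)` in the variable `tan t`. -/
noncomputable def legendreK (m u : ℝ) : ℝ := 1 / (√(1 + u ^ 2) * √(1 + (1 - m) * u ^ 2))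

/-- The integrand of `E(m)` in the variable `tan t`. -/
noncomputable def legendreE (m u : ℝ) : ℝ := √(1 + (1 - m) * u ^ 2) / √(1 + u ^ 2) / (1 + u ^ 2)

theorem ellipticK_eq (hm : m < 1) : ellipticK m = ∫ u in Ioi 0, legendreK m u := by
  rw [ellipticK, integral_zero_pi_div_two_eq]
  refine setIntegral_congr_fun measurableSet_Ioi fun u _ => ?_
  have ha : 0 < 1 + u ^ 2 := by positivity
  have hb : 0 < 1 + (1 - m) * u ^ 2 := by nlinarith [sq_nonneg u]
  simp only [one_sub_mul_sin_arctan_sq, legendreK]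
  rw [Real.sqrt_div hb.le]
  have h2 := Real.sq_sqrt ha.le
  have := Real.sqrt_pos.2 ha
  have := Real.sqrt_pos.2 hb
  nth_rewrite 2 [← h2]
  field_simp

theorem ellipticE_eq (hm : m < 1) : ellipticE m = ∫ u in Ioi 0, legendreE m u := by
  rw [ellipticE, integral_zero_pi_div_two_eq]
  refine setIntegral_congr_fun measurableSet_Ioi fun u _ => ?_
  have hb : 0 < 1 + (1 - m) * u ^ 2 := by nlinarith [sq_nonneg u]
  simp only [one_sub_mul_sin_arctan_sq, legendreE]
  rw [Real.sqrt_div hb.le]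

theorem ellipticPi_eq {n : ℝ} (hm : m < 1) (hn : n < 1) : ellipticPi n m
    = ∫ u in Ioi 0, (1 + u ^ 2) / (1 + (1 - n) * u ^ 2) * legendreK m u := by
  rw [ellipticPi, integral_zero_pi_div_two_eq]
  refine setIntegral_congr_fun measurableSet_Ioi fun u _ => ?_
  have ha : 0 < 1 + u ^ 2 := by positivity
  have hb : 0 < 1 + (1 - m) * u ^ 2 := by nlinarith [sq_nonneg u]
  have hc : 0 < 1 + (1 - n) * u ^ 2 := by nlinarith [sq_nonneg u]
  simp only [one_sub_mul_sin_arctan_sq, legendreK]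
  rw [Real.sqrt_div hb.le]
  have h2 := Real.sq_sqrt ha.le
  have := Real.sqrt_pos.2 ha
  have := Real.sqrt_pos.2 hb
  field_simp
  rw [h2]

theorem integrable_of_abs_le_div {f : ℝ → ℝ} (hf : Continuous f) (C : ℝ)
    (h : ∀ u, |f u| ≤ C / (1 + u ^ 2)) : Integrable f := by
  refine (integrable_inv_one_add_sq.const_mul C).mono' hf.aestronglyMeasurable
    (Eventually.of_forall fun u => ?_)
  simpa [div_eq_mul_inv] using h u

theorem legendreK_nonneg (m u : ℝ) : 0 ≤ legendreK m u := by unfold legendreK; positivity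

theorem continuous_legendreK (hm : m < 1) : Continuous (legendreK m) := by
  unfold legendreK
  refine Continuous.div (by fun_prop) (by fun_prop) fun u => ?_
  have hb : 0 < 1 + (1 - m) * u ^ 2 := by nlinarith [sq_nonneg u]
  positivity

theorem sqrt_mul_sqrt_one_add_le (hm0 : 0 ≤ m) (hm : m < 1) (u : ℝ) :
    √(1 - m) * √(1 + u ^ 2) ≤ √(1 + (1 - m) * u ^ 2) := by
  rw [← Real.sqrt_mul (by linarith)]
  exact Real.sqrt_le_sqrt (by nlinarith [sq_nonneg u])

theorem legendreK_le (hm0 : 0 ≤ m) (hm : m < 1) (u : ℝ) :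
    legendreK m u ≤ (1 / √(1 - m)) / (1 + u ^ 2) := by
  have hk : 0 < √(1 - m) := Real.sqrt_pos.2 (by linarith)
  have ha : 0 < 1 + u ^ 2 := by positivity
  rw [legendreK, div_div]
  refine one_div_le_one_div_of_le (by positivity) ?_
  have h2 := Real.mul_self_sqrt ha.le
  calc √(1 - m) * (1 + u ^ 2) = √(1 + u ^ 2) * (√(1 - m) * √(1 + u ^ 2)) := by
        rw [mul_left_comm, h2]
    _ ≤ _ := mul_le_mul_of_nonneg_left (sqrt_mul_sqrt_one_add_le hm0 hm u) (Real.sqrt_nonneg _)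

theorem integrable_mul_legendreK (hm0 : 0 ≤ m) (hm : m < 1) {g : ℝ → ℝ} (hg : Continuous g)
    {C : ℝ} (hC : ∀ u, |g u| ≤ C) : Integrable fun u => g u * legendreK m u := by
  refine integrable_of_abs_le_div (hg.mul (continuous_legendreK hm)) (C * (1 / √(1 - m))) fun u => ?_
  rw [abs_mul, abs_of_nonneg (legendreK_nonneg m u), mul_div_assoc]
  exact mul_le_mul (hC u) (legendreK_le hm0 hm u) (legendreK_nonneg m u)
    ((abs_nonneg _).trans (hC u))

theorem integrable_legendreK (hm0 : 0 ≤ m) (hm : m < 1) : Integrable (legendreK m) := by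
  simpa using integrable_mul_legendreK hm0 hm (g := fun _ => 1) continuous_const (C := 1) (by simp)

/-- A second-kind integrand with a pole at infinity, regularised there. -/
noncomputable def legendreD (m u : ℝ) : ℝ := √(1 + (1 - m) * u ^ 2) / √(1 + u ^ 2) - √(1 - m)

theorem legendreD_nonneg (hm0 : 0 ≤ m) (hm : m < 1) (u : ℝ) : 0 ≤ legendreD m u := by
  have ha : 0 < √(1 + u ^ 2) := Real.sqrt_pos.2 (by positivity)
  rw [legendreD, sub_nonneg, le_div_iff₀ ha]
  exact sqrt_mul_sqrt_one_add_le hm0 hm u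

theorem legendreD_le (hm0 : 0 ≤ m) (hm : m < 1) (u : ℝ) :
    legendreD m u ≤ (m / √(1 - m)) / (1 + u ^ 2) := by
  have hk : 0 < √(1 - m) := Real.sqrt_pos.2 (by linarith)
  have hk2 := Real.sq_sqrt (show 0 ≤ 1 - m by linarith)
  have ha : 0 < 1 + u ^ 2 := by positivity
  have hb : 0 < 1 + (1 - m) * u ^ 2 := by nlinarith [sq_nonneg u]
  have h0 := legendreD_nonneg hm0 hm u
  have h1 : (legendreD m u + √(1 - m)) ^ 2 = (1 + (1 - m) * u ^ 2) / (1 + u ^ 2) := by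
    rw [legendreD, sub_add_cancel, div_pow, Real.sq_sqrt ha.le, Real.sq_sqrt hb.le]
  have h2 : (legendreD m u + √(1 - m)) ^ 2 = (1 - m) + m / (1 + u ^ 2) := by
    rw [h1]; field_simp; ring
  rw [div_div, mul_comm, ← div_div, le_div_iff₀ hk]
  nlinarith

theorem continuous_sqrt_div_sqrt : Continuous fun u : ℝ =>
    √(1 + (1 - m) * u ^ 2) / √(1 + u ^ 2) :=
  Continuous.div (by fun_prop) (by fun_prop) fun _ => (Real.sqrt_pos.2 (by positivity)).ne'

theorem integrable_legendreD (hm0 : 0 ≤ m) (hm : m < 1) : Integrable (legendreD m) := by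
  refine integrable_of_abs_le_div (continuous_sqrt_div_sqrt.sub continuous_const) (m / √(1 - m))
    fun u => ?_
  rw [abs_of_nonneg (by exact legendreD_nonneg hm0 hm u)]
  exact legendreD_le hm0 hm u

theorem integrable_legendreE (hm0 : 0 ≤ m) (hm : m < 1) : Integrable (legendreE m) := by
  refine integrable_of_abs_le_div (continuous_sqrt_div_sqrt.div (by fun_prop)
    fun u => (show (0 : ℝ) < 1 + u ^ 2 by positivity).ne') 1 fun u => ?_
  have ha : 0 < √(1 + u ^ 2) := Real.sqrt_pos.2 (by positivity)
  rw [abs_of_nonneg (show 0 ≤ legendreE m u by unfold legendreE; positivity)]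
  refine div_le_div_of_nonneg_right ?_ (by positivity)
  rw [div_le_one ha]
  exact Real.sqrt_le_sqrt (by nlinarith [sq_nonneg u])

/-- An exact derivative linking the `D`, `K` and `E` integrands. It eliminates the `D` integral,
because `u * legendreD m u` vanishes at `0` and is `O(1/u)` at infinity. -/
theorem hasDerivAt_mul_legendreD (hm : m < 1) (u : ℝ) :
    HasDerivAt (fun u => u * legendreD m u)
      (legendreD m u - legendreK m u + legendreE m u) u := by
  have ha : 0 < 1 + u ^ 2 := by positivity
  have hb : 0 < 1 + (1 - m) * u ^ 2 := by nlinarith [sq_nonneg u]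
  have hda : HasDerivAt (fun u : ℝ => √(1 + u ^ 2)) (2 * u / (2 * √(1 + u ^ 2))) u := by
    simpa using ((hasDerivAt_pow 2 u).const_add 1).sqrt ha.ne'
  have hdb : HasDerivAt (fun u : ℝ => √(1 + (1 - m) * u ^ 2))
      ((1 - m) * (2 * u) / (2 * √(1 + (1 - m) * u ^ 2))) u := by
    simpa using (((hasDerivAt_pow 2 u).const_mul (1 - m)).const_add 1).sqrt hb.ne'
  have hA := Real.sqrt_pos.2 ha
  have hB := Real.sqrt_pos.2 hb
  have h := (hasDerivAt_id u).mul ((hdb.div hda hA.ne').sub_const (√(1 - m)))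
  refine h.congr_deriv ?_
  simp only [legendreD, legendreK, legendreE, id, Pi.div_apply]
  have hA2 := Real.sq_sqrt ha.le
  have hB2 := Real.sq_sqrt hb.le
  rw [← sub_eq_zero]
  set X := √(1 + u ^ 2)
  set Y := √(1 + (1 - m) * u ^ 2)
  rw [← hA2]
  field_simp
  linear_combination (u ^ 2 * (1 - m) + 1) * hA2 - (u ^ 2 + 1) * hB2

theorem integral_legendreD (hm0 : 0 ≤ m) (hm : m < 1) :
    ∫ u in Ioi 0, legendreD m u = ellipticK m - ellipticE m := by
  have hK := (integrable_legendreK hm0 hm).integrableOn (s := Ioi 0)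
  have hE := (integrable_legendreE hm0 hm).integrableOn (s := Ioi 0)
  have hD := (integrable_legendreD hm0 hm).integrableOn (s := Ioi 0)
  have hlim : Tendsto (fun u => u * legendreD m u) atTop (𝓝 0) := by
    have h1 : Tendsto (fun u : ℝ => (m / √(1 - m)) / u) atTop (𝓝 0) :=
      tendsto_const_nhds.div_atTop tendsto_id
    refine tendsto_of_tendsto_of_tendsto_of_le_of_le' tendsto_const_nhds h1 ?_ ?_
    · filter_upwards [eventually_gt_atTop 0] with u hu
      exact mul_nonneg hu.le (legendreD_nonneg hm0 hm u)
    · filter_upwards [eventually_gt_atTop 0] with u hu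
      have h2 := legendreD_le hm0 hm u
      refine (mul_le_mul_of_nonneg_left h2 hu.le).trans ?_
      rw [← mul_div_assoc, div_le_div_iff₀ (by positivity) hu]
      have : 0 ≤ m / √(1 - m) := by positivity
      nlinarith
  have h := integral_Ioi_of_hasDerivAt_of_tendsto' (a := 0)
    (fun u _ => hasDerivAt_mul_legendreD hm u) ((hD.sub hK).add hE) hlim
  rw [integral_add (by exact hD.sub hK) hE, integral_sub hD hK, ← ellipticK_eq hm, ← ellipticE_eq hm] at h
  linarith

theorem abs_one_add_sq_div_le {c : ℝ} (hc : 0 < c) (hc1 : c ≤ 1) (u : ℝ) :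
    |(1 + u ^ 2) / (1 + c * u ^ 2)| ≤ 1 / c := by
  have h : 0 < 1 + c * u ^ 2 := by positivity
  rw [abs_of_nonneg (by positivity), div_le_div_iff₀ h hc]
  nlinarith [sq_nonneg u]

theorem integrable_legendrePi {n : ℝ} (hm0 : 0 ≤ m) (hm : m < 1) (hn0 : 0 ≤ n) (hn : n < 1) :
    Integrable fun u => (1 + u ^ 2) / (1 + (1 - n) * u ^ 2) * legendreK m u := by
  have hn' : 0 < 1 - n := by linarith
  refine integrable_mul_legendreK hm0 hm (Continuous.div (by fun_prop) (by fun_prop) fun u => ?_)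
    (abs_one_add_sq_div_le hn' (by linarith))
  positivity

/-- Two complete elliptic integrals of the third kind whose characteristics have product `m`. -/
theorem ellipticPi_add_ellipticPi {n₁ n₂ : ℝ} (hn₁ : 0 ≤ n₁) (hn₁' : n₁ < 1) (hn₂ : 0 ≤ n₂)
    (hn₂' : n₂ < 1) (hm : n₁ * n₂ = m) :
    ellipticPi n₁ m + ellipticPi n₂ m = ellipticK m + π / (2 * √((1 - n₁) * (1 - n₂))) := by
  have hm0 : 0 ≤ m := by rw [← hm]; positivity
  have hm1 : m < 1 := by rw [← hm]; nlinarith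
  set c := √((1 - n₁) * (1 - n₂)) with hc
  have hcpos : 0 < (1 - n₁) * (1 - n₂) := mul_pos (by linarith) (by linarith)
  have hc0 : 0 < c := Real.sqrt_pos.2 hcpos
  have hc2 : c ^ 2 = (1 - n₁) * (1 - n₂) := Real.sq_sqrt hcpos.le
  have hK := (integrable_legendreK hm0 hm1).integrableOn (s := Ioi 0)
  have h1 := (integrable_legendrePi hm0 hm1 hn₁ hn₁').integrableOn (s := Ioi 0)
  have h2 := (integrable_legendrePi hm0 hm1 hn₂ hn₂').integrableOn (s := Ioi 0)
  -- The combination `Π₁ + Π₂ - K` has an elementary primitive. This rests on `(1 + (1-m)u²) + c² u²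
  -- (1+u²)` factoring as `(1 + (1-n₁)u²)(1 + (1-n₂)u²)`, which uses `n₁ n₂ = m`.
  have hderiv : ∀ u : ℝ, HasDerivAt
      (fun u => arctan (c * (u * √(1 + u ^ 2) / √(1 + (1 - m) * u ^ 2))) / c)
      ((1 + u ^ 2) / (1 + (1 - n₁) * u ^ 2) * legendreK m u
        + (1 + u ^ 2) / (1 + (1 - n₂) * u ^ 2) * legendreK m u - legendreK m u) u := by
    intro u
    have ha : 0 < 1 + u ^ 2 := by positivity
    have hb : 0 < 1 + (1 - m) * u ^ 2 := by nlinarith [sq_nonneg u]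
    have hp1 : 0 < 1 + (1 - n₁) * u ^ 2 := by nlinarith [sq_nonneg u]
    have hp2 : 0 < 1 + (1 - n₂) * u ^ 2 := by nlinarith [sq_nonneg u]
    have hda : HasDerivAt (fun u : ℝ => √(1 + u ^ 2)) (2 * u / (2 * √(1 + u ^ 2))) u := by
      simpa using ((hasDerivAt_pow 2 u).const_add 1).sqrt ha.ne'
    have hdb : HasDerivAt (fun u : ℝ => √(1 + (1 - m) * u ^ 2))
        ((1 - m) * (2 * u) / (2 * √(1 + (1 - m) * u ^ 2))) u := by
      simpa using (((hasDerivAt_pow 2 u).const_mul (1 - m)).const_add 1).sqrt hb.ne'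
    have hA := Real.sqrt_pos.2 ha
    have hB := Real.sqrt_pos.2 hb
    have h := (((((hasDerivAt_id u).mul hda).div hdb hB.ne').const_mul c).arctan).div_const c
    refine h.congr_deriv ?_
    simp only [legendreK, id, Pi.mul_apply, Pi.div_apply]
    have hA2 := Real.sq_sqrt ha.le
    have hB2 := Real.sq_sqrt hb.le
    set X := √(1 + u ^ 2)
    set Y := √(1 + (1 - m) * u ^ 2)
    have hden : 1 + (c * (u * X / Y)) ^ 2
        = (1 + (1 - n₁) * u ^ 2) * (1 + (1 - n₂) * u ^ 2) / Y ^ 2 := by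
      have h3 : 1 + (c * (u * X / Y)) ^ 2 = (Y ^ 2 + c ^ 2 * u ^ 2 * X ^ 2) / Y ^ 2 := by
        field_simp
      rw [h3, hc2, hA2, hB2, ← hm]
      ring
    have key : (X ^ 2 + u ^ 2) * Y ^ 2 - u ^ 2 * X ^ 2 * (1 - m)
        = X ^ 2 * ((1 + (1 - n₁) * u ^ 2) + (1 + (1 - n₂) * u ^ 2))
          - (1 + (1 - n₁) * u ^ 2) * (1 + (1 - n₂) * u ^ 2) := by
      rw [hA2, hB2, ← hm]
      ring
    rw [hden, ← hA2]
    generalize 1 + (1 - n₁) * u ^ 2 = p₁ at *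
    generalize 1 + (1 - n₂) * u ^ 2 = p₂ at *
    field_simp
    linear_combination key
  have hlim : Tendsto (fun u => arctan (c * (u * √(1 + u ^ 2) / √(1 + (1 - m) * u ^ 2))) / c)
      atTop (𝓝 (π / 2 / c)) := by
    refine Tendsto.div_const ?_ c
    refine (tendsto_arctan_atTop.mono_right nhdsWithin_le_nhds).comp ?_
    refine Tendsto.const_mul_atTop hc0 ?_
    refine tendsto_atTop_mono' _ ?_ tendsto_id
    filter_upwards [eventually_ge_atTop 0] with u hu
    have hb : 0 < 1 + (1 - m) * u ^ 2 := by nlinarith [sq_nonneg u]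
    have hB := Real.sqrt_pos.2 hb
    rw [id, le_div_iff₀ hB]
    refine mul_le_mul_of_nonneg_left (Real.sqrt_le_sqrt ?_) hu
    nlinarith [sq_nonneg u]
  have h := integral_Ioi_of_hasDerivAt_of_tendsto' (a := 0) (fun u _ => hderiv u)
    ((h1.add h2).sub hK) hlim
  rw [integral_sub (by exact h1.add h2) hK, integral_add h1 h2, ← ellipticK_eq hm1,
    ← ellipticPi_eq hm1 hn₁', ← ellipticPi_eq hm1 hn₂'] at h
  rw [← sub_eq_iff_eq_add', h]
  simp
  ring

end Legendre

/-! ### Evaluation of the averages at the modulus belonging to `r` -/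

/-- The modulus parameter `m` belonging to `r`. -/
noncomputable def modParam (r : ℝ) : ℝ := 16 * r / ((r + 3) * (r - 1) ^ 3)

section Modulus
variable {r : ℝ}

theorem one_sub_modParam (hr : 3 < r) :
    1 - modParam r = (r + 1) ^ 3 * (r - 3) / ((r + 3) * (r - 1) ^ 3) := by
  have h1 : r - 1 ≠ 0 := by linarith
  have h3 : r + 3 ≠ 0 := by linarith
  rw [modParam]
  field_simp
  ring

theorem modParam_nonneg (hr : 3 < r) : 0 ≤ modParam r := by
  have h1 : 0 < r - 1 := by linarith
  unfold modParam
  positivity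

theorem modParam_lt_one (hr : 3 < r) : modParam r < 1 := by
  have h1 : 0 < r - 1 := by linarith
  have h3 : 0 < r - 3 := by linarith
  have : 0 < 1 - modParam r := by rw [one_sub_modParam hr]; positivity
  linarith

/-- The scaling factor between `tan` of the angle on the torus and `tan` of the amplitude. -/
noncomputable def tanScale (r : ℝ) : ℝ := √((r - 3) * (r + 1)) / (r - 1)

theorem sqrt_pos_of_three_lt (hr : 3 < r) : 0 < √((r - 3) * (r + 1)) :=
  Real.sqrt_pos.2 (mul_pos (by linarith) (by linarith))

theorem sqrt_pos_of_three_lt' (hr : 3 < r) : 0 < √((r + 3) * (r - 1)) :=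
  Real.sqrt_pos.2 (mul_pos (by linarith) (by linarith))

theorem sq_sqrt_of_three_lt (hr : 3 < r) : √((r - 3) * (r + 1)) ^ 2 = (r - 3) * (r + 1) :=
  Real.sq_sqrt (mul_pos (by linarith) (by linarith)).le

theorem sq_sqrt_of_three_lt' (hr : 3 < r) : √((r + 3) * (r - 1)) ^ 2 = (r + 3) * (r - 1) :=
  Real.sq_sqrt (mul_pos (by linarith) (by linarith)).le

theorem tanScale_pos (hr : 3 < r) : 0 < tanScale r :=
  div_pos (sqrt_pos_of_three_lt hr) (by linarith)

theorem tanScale_sq (hr : 3 < r) : tanScale r ^ 2 = (r - 3) * (r + 1) / (r - 1) ^ 2 := by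
  rw [tanScale, div_pow, sq_sqrt_of_three_lt hr]

theorem one_sub_tanScale_sq (hr : 3 < r) : 1 - 4 / (r - 1) ^ 2 = tanScale r ^ 2 := by
  have h1 : r - 1 ≠ 0 := by linarith
  rw [tanScale_sq hr]
  field_simp
  ring

theorem sqrt_one_sub_modParam (hr : 3 < r) : √(1 - modParam r)
    = (r + 1) * √((r - 3) * (r + 1)) / ((r - 1) * √((r + 3) * (r - 1))) := by
  have h1 : 0 < r - 1 := by linarith
  have h3 : 0 < r + 3 := by linarith
  rw [one_sub_modParam hr]
  refine (Real.sqrt_eq_iff_mul_self_eq_of_pos ?_).2 ?_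
  · have := sqrt_pos_of_three_lt hr
    have := sqrt_pos_of_three_lt' hr
    positivity
  · rw [← pow_two, div_pow, mul_pow, mul_pow, sq_sqrt_of_three_lt hr, sq_sqrt_of_three_lt' hr]
    field_simp

/-- The scale is chosen so that, at `x = 4 / (1 + s²)` with `s = tanScale r * u`, the factor `(r-1)²
- x` becomes a multiple of `(1 + u²) / (1 + s²)`. The factor `(r+1)² - x` then becomes a multiple of
`(1 + (1-m)u²) / (1 + s²)`, and this fixes `m`. -/
theorem innerAverage_tanScale (hr : 3 < r) (u : ℝ) :
    innerAverage r (4 / (1 + (tanScale r * u) ^ 2))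
      = (1 + (tanScale r * u) ^ 2) / (√((r - 3) * (r + 1)) * √((r + 3) * (r - 1)))
        * legendreK (modParam r) u := by
  have h1 : 0 < r - 1 := by linarith
  have h3 : 0 < r + 3 := by linarith
  have hm := modParam_lt_one hr
  have hT := sqrt_pos_of_three_lt hr
  have hS := sqrt_pos_of_three_lt' hr
  have ha : 0 < 1 + u ^ 2 := by positivity
  have hb : 0 < 1 + (1 - modParam r) * u ^ 2 := by nlinarith [sq_nonneg u]
  have hA := Real.sqrt_pos.2 ha
  have hB := Real.sqrt_pos.2 hb
  have hq : 0 < 1 + (tanScale r * u) ^ 2 := by positivity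
  have h : √(((r - 1) ^ 2 - 4 / (1 + (tanScale r * u) ^ 2)) *
      ((r + 1) ^ 2 - 4 / (1 + (tanScale r * u) ^ 2)))
      = √((r - 3) * (r + 1)) * √((r + 3) * (r - 1)) *
        (√(1 + u ^ 2) * √(1 + (1 - modParam r) * u ^ 2)) / (1 + (tanScale r * u) ^ 2) := by
    refine (Real.sqrt_eq_iff_mul_self_eq_of_pos (by positivity)).2 ?_
    rw [← pow_two, div_pow, mul_pow, mul_pow, mul_pow, sq_sqrt_of_three_lt hr,
      sq_sqrt_of_three_lt' hr, Real.sq_sqrt ha.le, Real.sq_sqrt hb.le]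
    rw [div_eq_iff (by positivity)]
    have e1 : ((r - 1) ^ 2 - 4 / (1 + (tanScale r * u) ^ 2)) * (1 + (tanScale r * u) ^ 2)
        = (r - 3) * (r + 1) * (1 + u ^ 2) := by
      rw [sub_mul, div_mul_cancel₀ _ hq.ne', mul_pow, tanScale_sq hr]
      field_simp
      ring
    have e2 : ((r + 1) ^ 2 - 4 / (1 + (tanScale r * u) ^ 2)) * (1 + (tanScale r * u) ^ 2)
        = (r + 3) * (r - 1) * (1 + (1 - modParam r) * u ^ 2) := by
      rw [sub_mul, div_mul_cancel₀ _ hq.ne', mul_pow, tanScale_sq hr, one_sub_modParam hr]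
      field_simp
      ring
    linear_combination (-(r - 3) * (r + 1) * (1 + u ^ 2)) * e2 -
      ((r + 1) ^ 2 - 4 / (1 + (tanScale r * u) ^ 2)) * (1 + (tanScale r * u) ^ 2) * e1
  rw [innerAverage, h, legendreK]
  field_simp

theorem integral_unitExp_norm_one_add_tanScale (hr : 3 < r) (H : ℝ → ℝ) :
    ∫ a, H (‖1 + unitExp a‖ ^ 2) ∂AddCircle.haarAddCircle
      = 2 / π * (tanScale r * ∫ u in Ioi 0,
        H (4 / (1 + (tanScale r * u) ^ 2)) / (1 + (tanScale r * u) ^ 2)) := by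
  rw [integral_unitExp_norm_one_add]
  congr 1
  have h := integral_comp_mul_left_Ioi' (fun s => H (4 / (1 + s ^ 2)) / (1 + s ^ 2)) 0
    (tanScale_pos hr)
  rw [mul_zero, smul_eq_mul] at h
  exact h.symm

theorem integral_innerAverage (hr : 3 < r) :
    ∫ a, innerAverage r (‖1 + unitExp a‖ ^ 2) ∂AddCircle.haarAddCircle
      = 2 / π * (ellipticK (modParam r) / ((r - 1) * √((r + 3) * (r - 1)))) := by
  have h1 : 0 < r - 1 := by linarith
  have hT := sqrt_pos_of_three_lt hr
  have hS := sqrt_pos_of_three_lt' hr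
  rw [integral_unitExp_norm_one_add_tanScale hr, ellipticK_eq (modParam_lt_one hr)]
  have h : ∀ u, innerAverage r (4 / (1 + (tanScale r * u) ^ 2)) / (1 + (tanScale r * u) ^ 2)
      = 1 / (√((r - 3) * (r + 1)) * √((r + 3) * (r - 1))) * legendreK (modParam r) u := by
    intro u
    have hq : 0 < 1 + (tanScale r * u) ^ 2 := by positivity
    rw [innerAverage_tanScale hr]
    field_simp
  simp_rw [h]
  rw [integral_const_mul, tanScale]
  field_simp

theorem integrable_inv_one_add_tanScale (hr : 3 < r) :
    Integrable fun u => 1 / (1 + (tanScale r * u) ^ 2) := by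
  simpa [one_div] using integrable_inv_one_add_sq.comp_mul_left' (tanScale_pos hr).ne'

theorem integral_inv_one_add_tanScale (hr : 3 < r) :
    tanScale r * ∫ u in Ioi 0, 1 / (1 + (tanScale r * u) ^ 2) = π / 2 := by
  have h := integral_comp_mul_left_Ioi' (fun s : ℝ => (1 + s ^ 2)⁻¹) 0 (tanScale_pos hr)
  rw [mul_zero, smul_eq_mul, integral_Ioi_inv_one_add_sq] at h
  simpa [one_div] using h

theorem integrable_legendreK_div (hr : 3 < r) :
    Integrable fun u => 1 / (1 + (tanScale r * u) ^ 2) * legendreK (modParam r) u := by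
  refine integrable_mul_legendreK (modParam_nonneg hr) (modParam_lt_one hr)
    (Continuous.div (by fun_prop) (by fun_prop) fun u => ?_) (C := 1) fun u => ?_
  · positivity
  · rw [abs_of_nonneg (by positivity), div_le_one (by positivity)]
    nlinarith [sq_nonneg (tanScale r * u)]

/-- The third-kind integral with characteristic `4 / (r - 1)²`, up to a multiple of `K`. -/
theorem integral_legendreK_div (hr : 3 < r) :
    4 * ∫ u in Ioi 0, 1 / (1 + (tanScale r * u) ^ 2) * legendreK (modParam r) u
      = (r - 1) ^ 2 * ellipticK (modParam r)
        - (r - 3) * (r + 1) * ellipticPi (4 / (r - 1) ^ 2) (modParam r) := by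
  have h1 : 0 < r - 1 := by linarith
  have h3 : 0 < r - 3 := by linarith
  have hm := modParam_lt_one hr
  have hn : 4 / (r - 1) ^ 2 < 1 := by
    rw [div_lt_one (by positivity)]; nlinarith
  have hn0 : 0 ≤ 4 / (r - 1) ^ 2 := by positivity
  have hK := (integrable_legendreK (modParam_nonneg hr) hm).integrableOn (s := Ioi 0)
  have hP := (integrable_legendrePi (modParam_nonneg hr) hm hn0 hn).integrableOn (s := Ioi 0)
  rw [ellipticK_eq hm, ellipticPi_eq hm hn, ← integral_const_mul, ← integral_const_mul,
    ← integral_const_mul, ← integral_sub (hK.const_mul _) (hP.const_mul _)]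
  refine setIntegral_congr_fun measurableSet_Ioi fun u _ => ?_
  have hq : 0 < 1 + tanScale r ^ 2 * u ^ 2 := by positivity
  have hs := tanScale_sq hr
  rw [eq_div_iff (by positivity)] at hs
  simp only [one_sub_tanScale_sq hr, mul_pow, ← hs]
  generalize legendreK (modParam r) u = k
  generalize tanScale r ^ 2 = t at *
  field_simp
  linear_combination k * hs

theorem integral_fourierC_one (hr : 3 < r) :
    ∫ a, ((r ^ 2 - 1 + ‖1 + unitExp a‖ ^ 2) * innerAverage r (‖1 + unitExp a‖ ^ 2) - 1)
        ∂AddCircle.haarAddCircle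
      = 2 / π * (((r ^ 2 - 1) * ellipticK (modParam r) +
        4 * ∫ u in Ioi 0, 1 / (1 + (tanScale r * u) ^ 2) * legendreK (modParam r) u)
          / ((r - 1) * √((r + 3) * (r - 1)))) - 1 := by
  have h1 : 0 < r - 1 := by linarith
  have hT := sqrt_pos_of_three_lt hr
  have hS := sqrt_pos_of_three_lt' hr
  have hm := modParam_lt_one hr
  rw [integral_unitExp_norm_one_add_tanScale hr (fun x => (r ^ 2 - 1 + x) * innerAverage r x - 1)]
  have h : ∀ u, ((r ^ 2 - 1 + 4 / (1 + (tanScale r * u) ^ 2)) *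
      innerAverage r (4 / (1 + (tanScale r * u) ^ 2)) - 1) / (1 + (tanScale r * u) ^ 2)
      = 1 / (√((r - 3) * (r + 1)) * √((r + 3) * (r - 1))) *
        ((r ^ 2 - 1) * legendreK (modParam r) u
          + 4 * (1 / (1 + (tanScale r * u) ^ 2) * legendreK (modParam r) u))
        - 1 / (1 + (tanScale r * u) ^ 2) := by
    intro u
    have hq : 0 < 1 + (tanScale r * u) ^ 2 := by positivity
    rw [innerAverage_tanScale hr]
    field_simp
  have hK := (integrable_legendreK (modParam_nonneg hr) hm).integrableOn (s := Ioi 0)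
  have hK2 := (integrable_legendreK_div hr).integrableOn (s := Ioi 0)
  have hI := (integrable_inv_one_add_tanScale hr).integrableOn (s := Ioi 0)
  simp_rw [h]
  rw [integral_sub (by exact ((hK.const_mul _).add (hK2.const_mul _)).const_mul _) hI,
    integral_const_mul, integral_add (by exact hK.const_mul _) (by exact hK2.const_mul _),
    integral_const_mul, integral_const_mul, ← ellipticK_eq hm, mul_sub,
    integral_inv_one_add_tanScale hr, tanScale]
  have := pi_pos
  field_simp

/-- The factor `1/x` cancels the Jacobian `1 / (1 + s²)`, so the difference `innerAverage r x - 1 /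
(r² - 1)` must itself be integrable in `u`. Subtracting the value at `x = 0`, which corresponds to
`u → ∞`, ensures this and produces `legendreD`, whence `E`. -/
theorem integral_fourierC_one_one (hr : 3 < r) :
    ∫ a, innerAverageOneOne r (‖1 + unitExp a‖ ^ 2) ∂AddCircle.haarAddCircle
      = 2 / π * (((r ^ 2 - 1) ^ 2 / 8 * (ellipticK (modParam r)
          - (r + 3) * (r - 1) / (r + 1) ^ 2 * ellipticE (modParam r)) - ellipticK (modParam r)
          + 2 * ∫ u in Ioi 0, 1 / (1 + (tanScale r * u) ^ 2) * legendreK (modParam r) u)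
          / ((r - 1) * √((r + 3) * (r - 1)))) - 1 / 2 := by
  have h1 : 0 < r - 1 := by linarith
  have h1' : 0 < r + 1 := by linarith
  have h2 : 0 < r ^ 2 - 1 := by nlinarith
  have h3 : 0 < r - 3 := by linarith
  have hT := sqrt_pos_of_three_lt hr
  have hS := sqrt_pos_of_three_lt' hr
  have hm := modParam_lt_one hr
  rw [integral_unitExp_norm_one_add_tanScale hr (innerAverageOneOne r)]
  have hL : ∀ u, innerAverage r (4 / (1 + (tanScale r * u) ^ 2)) - 1 / (r ^ 2 - 1)
      = 1 / (√((r - 3) * (r + 1)) * √((r + 3) * (r - 1))) *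
        ((1 - (r + 3) * (r - 1) / (r + 1) ^ 2) * legendreK (modParam r) u
          + (r + 3) * (r - 1) / (r + 1) ^ 2 * legendreD (modParam r) u) := by
    intro u
    rw [innerAverage_tanScale hr]
    have hA : 0 < √(1 + u ^ 2) := Real.sqrt_pos.2 (by positivity)
    have hb : 0 < 1 + (1 - modParam r) * u ^ 2 := by nlinarith [sq_nonneg u]
    have hB := Real.sqrt_pos.2 hb
    have hD : legendreD (modParam r) u = (1 + (1 - modParam r) * u ^ 2) * legendreK (modParam r) u
        - √(1 - modParam r) := by
      rw [legendreD, legendreK]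
      have hB2 := Real.sq_sqrt hb.le
      field_simp
      linear_combination hB2
    -- The weight `g = (r+3)(r-1)/(r+1)²` is forced by matching the `u²` terms. The constant left
    -- over from `legendreD` is then exactly `1 / (r² - 1)`, as `hc` records.
    have hg : (r + 3) * (r - 1) / (r + 1) ^ 2 * (1 - modParam r) = tanScale r ^ 2 := by
      rw [one_sub_modParam hr, tanScale_sq hr]
      field_simp
    have hc : 1 / (√((r - 3) * (r + 1)) * √((r + 3) * (r - 1))) *
        ((r + 3) * (r - 1) / (r + 1) ^ 2 * √(1 - modParam r)) = 1 / (r ^ 2 - 1) := by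
      have hS2 := sq_sqrt_of_three_lt' hr
      rw [sqrt_one_sub_modParam hr, show r ^ 2 - 1 = (r + 1) * (r - 1) by ring]
      generalize √((r + 3) * (r - 1)) = S at hS hS2 ⊢
      rw [← hS2]
      field_simp
    rw [hD, ← hc, mul_pow, ← hg]
    ring
  have h : ∀ u, innerAverageOneOne r (4 / (1 + (tanScale r * u) ^ 2)) /
        (1 + (tanScale r * u) ^ 2)
      = 1 / (√((r - 3) * (r + 1)) * √((r + 3) * (r - 1))) *
        (((r ^ 2 - 1) ^ 2 / 8 * (1 - (r + 3) * (r - 1) / (r + 1) ^ 2) - 1) *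
            legendreK (modParam r) u
          + (r ^ 2 - 1) ^ 2 / 8 * ((r + 3) * (r - 1) / (r + 1) ^ 2) * legendreD (modParam r) u
          + 2 * (1 / (1 + (tanScale r * u) ^ 2) * legendreK (modParam r) u))
        - 1 / 2 * (1 / (1 + (tanScale r * u) ^ 2)) := by
    intro u
    have hq : 0 < 1 + (tanScale r * u) ^ 2 := by positivity
    rw [innerAverageOneOne, if_neg (by positivity), hL, innerAverage_tanScale hr]
    generalize 1 + (tanScale r * u) ^ 2 = q at *
    generalize legendreK (modParam r) u = k
    generalize legendreD (modParam r) u = d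
    generalize (r + 3) * (r - 1) / (r + 1) ^ 2 = g
    rw [div_eq_mul_one_div q]
    generalize 1 / (√((r - 3) * (r + 1)) * √((r + 3) * (r - 1))) = w
    field_simp
    ring
  have hK := (integrable_legendreK (modParam_nonneg hr) hm).integrableOn (s := Ioi 0)
  have hK2 := (integrable_legendreK_div hr).integrableOn (s := Ioi 0)
  have hD := (integrable_legendreD (modParam_nonneg hr) hm).integrableOn (s := Ioi 0)
  have hI := (integrable_inv_one_add_tanScale hr).integrableOn (s := Ioi 0)
  simp only [h]
  rw [integral_sub (by exact (((hK.const_mul _).add (hD.const_mul _)).add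
      (hK2.const_mul _)).const_mul _) (by exact hI.const_mul _), integral_const_mul,
    integral_add (by exact (hK.const_mul _).add (hD.const_mul _)) (by exact hK2.const_mul _),
    integral_add (by exact hK.const_mul _) (by exact hD.const_mul _),
    integral_const_mul, integral_const_mul, integral_const_mul, integral_const_mul,
    ← ellipticK_eq hm, integral_legendreD (modParam_nonneg hr) hm, mul_sub, mul_left_comm _ (1 / 2),
    integral_inv_one_add_tanScale hr, tanScale]
  have := pi_pos
  field_simp
  ring

/-- The characteristics `4r / ((r+3)(r-1))` and `4 / (r-1)²` multiply to `m`, so each third-kind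
integral can be traded for the other. -/
theorem ellipticPi_add_ellipticPi_modParam (hr : 3 < r) :
    ellipticPi (4 * r / ((r + 3) * (r - 1))) (modParam r)
      + ellipticPi (4 / (r - 1) ^ 2) (modParam r)
      = ellipticK (modParam r)
        + π * ((r - 1) * √((r + 3) * (r - 1))) / (2 * ((r - 3) * (r + 1))) := by
  have h1 : 0 < r - 1 := by linarith
  have h3 : 0 < r - 3 := by linarith
  have h4 : 0 < r + 3 := by linarith
  have hS := sqrt_pos_of_three_lt' hr
  have e1 : 4 * r / ((r + 3) * (r - 1)) < 1 := by
    rw [div_lt_one (by positivity)]; nlinarith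
  have e2 : 4 / (r - 1) ^ 2 < 1 := by
    rw [div_lt_one (by positivity)]; nlinarith
  rw [ellipticPi_add_ellipticPi (by positivity) e1 (by positivity) e2]
  · have : √((1 - 4 * r / ((r + 3) * (r - 1))) * (1 - 4 / (r - 1) ^ 2))
        = (r - 3) * (r + 1) / ((r - 1) * √((r + 3) * (r - 1))) := by
      refine (Real.sqrt_eq_iff_mul_self_eq_of_pos (by positivity)).2 ?_
      rw [← pow_two, div_pow, mul_pow _ (√_), sq_sqrt_of_three_lt' hr]
      field_simp
      ring
    rw [this]
    field_simp
  · rw [modParam]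
    field_simp
    norm_num

end Modulus

/-! ### Consequences of the recurrence and assembly of the theorem -/

theorem fourierC_perm_of_eq (r : ℝ) {I J : Fin 3 → ℤ} (σ : Equiv.Perm (Fin 3))
    (h : ∀ i, I i = J (σ i)) : fourierC r I = fourierC r J := by
  rw [← fourierC_perm r J σ]
  exact congrArg _ (funext h)

theorem fourierC_recurrence_vec {r : ℝ} (hr : 3 < r) (a b c : ℕ) :
    fourierC r ![a, b, c] - 1 / (r : ℂ) * (fourierC r ![a - 1, b, c] + fourierC r ![a, b - 1, c]
      + fourierC r ![a, b, c - 1]) = if ![a, b, c] = 0 then 1 else 0 := by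
  have h := fourierC_recurrence hr ![a, b, c]
  rw [Fin.sum_univ_three] at h
  rw [← h]
  congr <;> ext i <;> fin_cases i <;> simp

theorem fourierC_one_zero_zero {r : ℝ} (hr : 3 < r) :
    fourierC r ![1, 0, 0] = (r : ℂ) / 3 * (fourierC r ![0, 0, 0] - 1) := by
  have hr0 : (r : ℂ) ≠ 0 := by exact_mod_cast (by linarith : r ≠ 0)
  -- At `J = 0` the three shifted coefficients all equal `c₁₀₀` by symmetry, and the right side is
  -- `1`.
  have h := fourierC_recurrence_vec hr 0 0 0
  have e1 : fourierC r ![-1, 0, 0] = fourierC r ![1, 0, 0] := by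
    rw [← fourierC_neg]; congr 1; simp
  have e2 : fourierC r ![0, -1, 0] = fourierC r ![1, 0, 0] := by
    rw [← e1]
    exact fourierC_perm_of_eq r (Equiv.swap 0 1) (by decide)
  have e3 : fourierC r ![0, 0, -1] = fourierC r ![1, 0, 0] := by
    rw [← e1]
    exact fourierC_perm_of_eq r (Equiv.swap 0 2) (by decide)
  rw [if_pos (by decide)] at h
  simp only [Nat.cast_zero, zero_sub, e1, e2, e3] at h
  field_simp at h ⊢
  linear_combination -h

theorem fourierC_one_one_one {r : ℝ} (hr : 3 < r) :
    fourierC r ![1, 1, 1] = 3 / (r : ℂ) * fourierC r ![0, 1, 1] := by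
  have h := fourierC_recurrence_vec hr 1 1 1
  have e2 : fourierC r ![1, 0, 1] = fourierC r ![0, 1, 1] :=
    fourierC_perm_of_eq r (Equiv.swap 0 1) (by decide)
  have e3 : fourierC r ![1, 1, 0] = fourierC r ![0, 1, 1] :=
    fourierC_perm_of_eq r (Equiv.swap 0 2) (by decide)
  rw [if_neg (by decide)] at h
  simp only [Nat.cast_one, sub_self, e2, e3] at h
  linear_combination h

theorem fourierC_zero_one_neg_one {r : ℝ} (hr : 3 < r) : fourierC r ![0, 1, -1]
    = 1 / 2 * ((r : ℂ) * fourierC r ![0, 0, 1] - fourierC r ![0, 0, 0]) := by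
  have hr0 : (r : ℂ) ≠ 0 := by exact_mod_cast (by linarith : r ≠ 0)
  have h := fourierC_recurrence_vec hr 0 0 1
  have e2 : fourierC r ![-1, 0, 1] = fourierC r ![0, 1, -1] :=
    fourierC_perm_of_eq r (finRotate 3).symm (by decide)
  have e3 : fourierC r ![0, -1, 1] = fourierC r ![0, 1, -1] :=
    fourierC_perm_of_eq r (Equiv.swap 1 2) (by decide)
  rw [if_neg (by decide)] at h
  simp only [Nat.cast_one, Nat.cast_zero, zero_sub, sub_self, e2, e3] at h
  field_simp at h ⊢
  linear_combination -h

theorem fourierC_one_one_neg_one {r : ℝ} (hr : 3 < r) : fourierC r ![1, 1, -1]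
    = (r : ℂ) * fourierC r ![0, 1, 1] - 2 * fourierC r ![0, 0, 1] := by
  have hr0 : (r : ℂ) ≠ 0 := by exact_mod_cast (by linarith : r ≠ 0)
  have h := fourierC_recurrence_vec hr 0 1 1
  have e2 : fourierC r ![-1, 1, 1] = fourierC r ![1, 1, -1] :=
    fourierC_perm_of_eq r (Equiv.swap 0 2) (by decide)
  have e3 : fourierC r ![0, 1, 0] = fourierC r ![0, 0, 1] :=
    fourierC_perm_of_eq r (Equiv.swap 1 2) (by decide)
  rw [if_neg (by decide)] at h
  simp only [Nat.cast_one, Nat.cast_zero, zero_sub, sub_self, e2, e3] at h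
  field_simp at h
  linear_combination -h

theorem exists_perm_representative (J : Fin 3 → ℤ) (hJ : ∀ i, J i = -1 ∨ J i = 0 ∨ J i = 1) :
    ∃ I ∈ ([![0, 0, 0], ![1, 0, 0], ![0, 1, 1], ![1, 1, 1], ![0, 1, -1], ![1, 1, -1]] :
          List (Fin 3 → ℤ)),
        ∃ σ : Equiv.Perm (Fin 3), (J = fun i => I (σ i)) ∨ (J = fun i => -I (σ i)) := by
  have h : J = ![J 0, J 1, J 2] := by ext i; fin_cases i <;> rfl
  rw [h]
  rcases hJ 0 with h0 | h0 | h0 <;> rcases hJ 1 with h1 | h1 | h1 <;>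
    rcases hJ 2 with h2 | h2 | h2 <;> rw [h0, h1, h2] <;> decide

/-- Three linear equations are combined: `c₀₀₀` in terms of `K`, `c₁₀₀` computed both by recurrence
and by integration, and `c₀₁₁` in terms of `K`, `E`, `Π`. -/
theorem elliptic_relations {r : ℝ} (hr : 3 < r) {X Y : ℝ}
    (hX : fourierC r ![0, 0, 0] = (X : ℂ)) (hY : fourierC r ![0, 1, 1] = (Y : ℂ)) :
    Y = 1 / 3 * (X - 1) - 1 / 2 +
      ((r + 3) * (r - 1) ^ 3 * ellipticK (modParam r)
          - (r + 3) * (r - 1) ^ 3 * ellipticE (modParam r)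
          + 4 * (r - 3) * (r + 1) * ellipticPi (4 / (r - 1) ^ 2) (modParam r)) /
        (4 * π * (r - 1) * √((r + 3) * (r - 1))) := by
  have h1 : 0 < r - 1 := by linarith
  have h1' : 0 < r + 1 := by linarith
  have hS := sqrt_pos_of_three_lt' hr
  have hpi := pi_pos
  have e0 := fourierC_zero_eq hr
  have e1 := fourierC_one_eq hr
  have e2 := fourierC_one_one_eq hr
  rw [integral_innerAverage hr, hX, Complex.ofReal_inj] at e0
  rw [integral_fourierC_one_one hr, hY, Complex.ofReal_inj] at e2
  rw [fourierC_one_zero_zero hr, integral_fourierC_one hr, hX] at e1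
  rw [show (r : ℂ) / 3 * ((X : ℂ) - 1) = ((r / 3 * (X - 1) : ℝ) : ℂ) by push_cast; ring,
    Complex.ofReal_inj] at e1
  have hP := integral_legendreK_div hr
  set I := ∫ u in Ioi 0, 1 / (1 + (tanScale r * u) ^ 2) * legendreK (modParam r) u
  have hI : I = ((r - 1) ^ 2 * ellipticK (modParam r)
        - (r - 3) * (r + 1) * ellipticPi (4 / (r - 1) ^ 2) (modParam r)) / 4 := by linarith
  rw [hI] at e1 e2
  set S := √((r + 3) * (r - 1))
  generalize ellipticK (modParam r) = K at *
  generalize ellipticE (modParam r) = E at *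
  generalize ellipticPi (4 / (r - 1) ^ 2) (modParam r) = P at *
  have hr0 : r ≠ 0 := by linarith
  -- Naming the common prefactor makes all three equations polynomial in `W`, `K`, `E`, `P`.
  obtain ⟨W, hW⟩ : ∃ W, W = 1 / (π * (r - 1) * S) := ⟨_, rfl⟩
  have hW1 : ∀ Z, 2 / π * (Z / ((r - 1) * S)) = 2 * W * Z := fun Z => by
    rw [hW]; field_simp
  have hW2 : ∀ Z, Z / (4 * π * (r - 1) * S) = W * Z / 4 := fun Z => by
    rw [hW]; field_simp
  have hE : (r ^ 2 - 1) ^ 2 * ((r + 3) * (r - 1) / (r + 1) ^ 2 * E)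
      = (r + 3) * (r - 1) ^ 3 * E := by
    rw [show r ^ 2 - 1 = (r + 1) * (r - 1) by ring]
    field_simp
  rw [hW1] at e0 e1 e2
  rw [hW2]
  have e1' : (X - 1) / 3 = (2 * W * ((r ^ 2 - 1) * K +
      4 * (((r - 1) ^ 2 * K - (r - 3) * (r + 1) * P) / 4)) - 1) / 4 := by
    rw [← mul_right_inj' hr0]
    linear_combination e1
  linear_combination e2 - 4 * e1' + e0 - W / 4 * hE

theorem mainTheorem9 (r : ℝ) (hr : 3 < r) :
    fourierC r ![1, 0, 0] = (r : ℂ) / 3 * (fourierC r ![0, 0, 0] - 1) ∧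
    fourierC r ![0, 1, 1] = 1 / 3 * (fourierC r ![0, 0, 0] - 1) +
      ((((r ^ 4 - 2 * r ^ 2 - 15) * ellipticK (16 * r / ((r + 3) * (r - 1) ^ 3))
          - (r + 3) * (r - 1) ^ 3 * ellipticE (16 * r / ((r + 3) * (r - 1) ^ 3))
          - 4 * (r - 3) * (r + 1) *
            ellipticPi (4 * r / ((r + 3) * (r - 1))) (16 * r / ((r + 3) * (r - 1) ^ 3))) /
        (4 * Real.pi * (r - 1) * Real.sqrt ((r + 3) * (r - 1))) : ℝ) : ℂ) ∧
    fourierC r ![0, 1, 1] = 1 / 3 * (fourierC r ![0, 0, 0] - 1) - 1 / 2 +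
      ((((r + 3) * (r - 1) ^ 3 * ellipticK (16 * r / ((r + 3) * (r - 1) ^ 3))
          - (r + 3) * (r - 1) ^ 3 * ellipticE (16 * r / ((r + 3) * (r - 1) ^ 3))
          + 4 * (r - 3) * (r + 1) *
            ellipticPi (4 / (r - 1) ^ 2) (16 * r / ((r + 3) * (r - 1) ^ 3))) /
        (4 * Real.pi * (r - 1) * Real.sqrt ((r + 3) * (r - 1))) : ℝ) : ℂ) ∧
    fourierC r ![1, 1, 1] = 3 / (r : ℂ) * fourierC r ![0, 1, 1] ∧
    fourierC r ![0, 1, -1] = 1 / 2 * ((r : ℂ) * fourierC r ![0, 0, 1] - fourierC r ![0, 0, 0]) ∧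
    fourierC r ![1, 1, -1] = (r : ℂ) * fourierC r ![0, 1, 1] - 2 * fourierC r ![0, 0, 1] ∧
    (∀ J : Fin 3 → ℤ, (∀ i, J i = -1 ∨ J i = 0 ∨ J i = 1) →
      (∀ σ : Equiv.Perm (Fin 3), fourierC r (fun i => J (σ i)) = fourierC r J) ∧
      fourierC r (-J) = fourierC r J ∧
      ∃ I ∈ ([![0, 0, 0], ![1, 0, 0], ![0, 1, 1], ![1, 1, 1], ![0, 1, -1], ![1, 1, -1]] :
          List (Fin 3 → ℤ)),
        ∃ σ : Equiv.Perm (Fin 3), (J = fun i => I (σ i)) ∨ (J = fun i => -I (σ i))) := by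
  obtain ⟨X, hX⟩ : ∃ X : ℝ, fourierC r ![0, 0, 0] = (X : ℂ) := ⟨_, fourierC_eq_ofReal hr _⟩
  obtain ⟨Y, hY⟩ : ∃ Y : ℝ, fourierC r ![0, 1, 1] = (Y : ℂ) := ⟨_, fourierC_eq_ofReal hr _⟩
  have h2 := elliptic_relations hr hX hY
  have h1 : Y = 1 / 3 * (X - 1) +
      ((r ^ 4 - 2 * r ^ 2 - 15) * ellipticK (modParam r)
          - (r + 3) * (r - 1) ^ 3 * ellipticE (modParam r)
          - 4 * (r - 3) * (r + 1) * ellipticPi (4 * r / ((r + 3) * (r - 1))) (modParam r)) /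
        (4 * π * (r - 1) * √((r + 3) * (r - 1))) := by
    have hr1 : 0 < r - 1 := by linarith
    have hr3 : 0 < r - 3 := by linarith
    have hS := sqrt_pos_of_three_lt' hr
    have hpi := pi_pos
    -- Replacing the characteristic flips the sign of the `Π` term. The `π` term contributes `1/2`,
    -- cancelling the `-1/2`, and the `K` coefficient becomes `(r+3)(r-1)³ + 4(r-3)(r+1) = r⁴ - 2r²
    -- - 15`.
    rw [h2, eq_sub_of_add_eq (ellipticPi_add_ellipticPi_modParam hr)]
    field_simp
    ring
  refine ⟨fourierC_one_zero_zero hr, ?_, ?_, fourierC_one_one_one hr,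
    fourierC_zero_one_neg_one hr, fourierC_one_one_neg_one hr, fun J hJ =>
      ⟨fourierC_perm r J, fourierC_neg r J, exists_perm_representative J hJ⟩⟩
  · rw [hX, hY, h1, modParam]
    push_cast
    ring
  · rw [hX, hY, h2, modParam]
    push_cast
    ring
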